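/- Let $H=\{z=x+iy: y>0\}$, and let $SH=\{(z,\zeta)\in H\times\mathbb C:|\zeta|=\operatorname{Im}z\}$ be its unit circle bundle, on which $\mathrm{SL}(2,\mathbb R)$ acts by $g\cdot(z,\zeta)=(g\cdot z,\,j(g,z)^{-2}\zeta)$, where $j(g,z)=cz+d$ for $g=\begin{pmatrix}a&b\\c&d\end{pmatrix}$. Let $dV=\frac{dx\,dy}{y^2}\frac{d\phi}{2\pi}$ be the invariant volume, $\zeta=ye^{i\phi}$. A smooth curve in $SH$ is horizontal if it has the form $t\mapsto G(t)\cdot(i,1)$ with $G$ a smooth curve in $\mathrm{SL}(2,\mathbb R)$ such that $G(t)^{-1}G'(t)$ is traceless and symmetric for all $t$. Let $\Gamma=\mathrm{SL}(2,\mathbb Z)$, $X=\Gamma\backslash H$, let $\mathcal F=\{|z|\ge1,\ |x|\le\frac12\}$ be the standard fundamental domain, and let $\mathcal S_k(X)$ be the space of the $\Gamma$-invariant functions $F(z,\zeta)=\zeta^kf(z)$ on $SH$ with $f$ holomorphic on $H$ and $F$ square integrable over the part of $SH$ above $\mathcal F$, with the inner product $\langle F,G\rangle=\int_{z\in\mathcal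 F}F\overline G\,dV$. A smooth curve $\gamma:\mathbb R\to H$ with $\gamma_0\cdot\gamma(t)=\gamma(t+T)$ for some $\gamma_0\in\Gamma$ and $T>0$ represents a closed curve in $X$ with domain $[0,T]$; it is a $\mathrm{BS}_k$ curve if the holonomy in $\Gamma\backslash SH$ of a horizontal lift $\tilde\gamma$ of $\gamma$ is a $k$-th root of unity, that is, $\tilde\gamma(T)=w\cdot(\gamma_0\cdot\tilde\gamma(0))$ with $w^k=1$, where $w\cdot(z,\zeta)=(z,w\zeta)$. Its state $|\gamma,k\rangle=\Pi_k(\delta_{\tilde\gamma})$, the projection to $\mathcal S_k(X)$ of the delta function along $\tilde\gamma$, is the element $u\in\mathcal S_k(X)$ with $\langle F,u\rangle=\int_0^TF(\tilde\gamma(t))\,dt$ for all $F\in\mathcal S_k(X)$; it depends on the choice of the lift $\tilde\gamma$ only through a factor of modulus one. **Corollary.** Let $m\ge1$ and $k\ge2$ be integers and $\gamma(t)=\frac{ik}{2\pi m}+t$. Then $\gamma$ is a $\mathrm{BS}_k$ curve in $X$ with domain $[0,1]$. The classical Poincaré series $$P_{m,k}(z)=\sum_{g\in\Gamma_\infty\backslash\Gamma}\frac{e^{2\pi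 im(g\cdot z)}}{j(g,z)^{2k}},\qquad \Gamma_\infty=\{g\in\Gamma: g\cdot\infty=\infty\},$$ converges absolutely for every $z\in H$. There is a constant $C\neq0$, depending only on $m$ and $k$, such that for every horizontal lift $\tilde\gamma$ of $\gamma$ there is $w\in\mathbb C$ with $|w|=1$ such that the state exists, is unique and is $$|\gamma,k\rangle(z,\zeta)=w\,C\,\zeta^kP_{m,k}(z).$$ -/

import Mathlib

open UpperHalfPlane MeasureTheory
open scoped MatrixGroups ComplexConjugate Manifold ContDiff

noncomputable section

namespace BohrSommerfeld

/-- The automorphy factor `j(g, z) = c z + d` of `g = (a b; c d) ∈ SL(2, ℝ)`. -/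
def j (g : SL(2, ℝ)) (z : ℍ) : ℂ := (g 1 0 : ℂ) * z + (g 1 1 : ℂ)

theorem j_eq_denom (g : SL(2, ℝ)) (z : ℍ) : j g z = denom (g : GL (Fin 2) ℝ) z := by
  simp [j, denom]

theorem j_ne_zero (g : SL(2, ℝ)) (z : ℍ) : j g z ≠ 0 := by
  rw [j_eq_denom]; exact denom_ne_zero _ z

theorem j_mul (g h : SL(2, ℝ)) (z : ℍ) : j (g * h) z = j g (h • z) * j h z := by
  rw [j_eq_denom, j_eq_denom, j_eq_denom, map_mul]
  have := denom_cocycle_σ (g : GL (Fin 2) ℝ) (h : GL (Fin 2) ℝ) z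
  have hs : h • z = (h : GL (Fin 2) ℝ) • z := rfl
  rw [hs]
  simpa [σ] using this

theorem j_one (z : ℍ) : j 1 z = 1 := by simp [j]

theorem im_smul_eq (g : SL(2, ℝ)) (z : ℍ) : (g • z).im = ‖j g z‖⁻¹ ^ 2 * z.im := by
  have h : (g • z).im = |((g : GL (Fin 2) ℝ).det.val)| * z.im /
      Complex.normSq (denom (g : GL (Fin 2) ℝ) z) := UpperHalfPlane.im_smul_eq_div_normSq _ z
  rw [h, ← j_eq_denom, Complex.normSq_eq_norm_sq]
  simp
  ring

/-- The unit circle bundle `SH = {(z, ζ) ∈ ℍ × ℂ : |ζ| = Im z}`. -/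
def SH : Type := {p : ℍ × ℂ // ‖p.2‖ = p.1.im}

instance : MeasurableSpace SH := inferInstanceAs (MeasurableSpace {p : ℍ × ℂ // ‖p.2‖ = p.1.im})

/-- The base point `z` of `(z, ζ) ∈ SH`. -/
def SH.z (p : SH) : ℍ := p.1.1

/-- The fibre coordinate `ζ` of `(z, ζ) ∈ SH`. -/
def SH.ζ (p : SH) : ℂ := p.1.2

theorem SH.ext {p q : SH} (h₁ : p.z = q.z) (h₂ : p.ζ = q.ζ) : p = q :=
  Subtype.ext (Prod.ext h₁ h₂)

/-- The action `g · (z, ζ) = (g · z, j(g, z)⁻² ζ)` of `SL(2, ℝ)` on `SH`. -/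
instance : MulAction SL(2, ℝ) SH where
  smul g p := ⟨(g • p.z, (j g p.z)⁻¹ ^ 2 * p.ζ), by
    have h : ‖p.ζ‖ = p.z.im := p.2
    simp only [norm_mul, norm_pow, norm_inv, h, im_smul_eq]⟩
  one_smul p := SH.ext (one_smul SL(2, ℝ) p.z)
    (show (j 1 p.z)⁻¹ ^ 2 * p.ζ = p.ζ by simp [j_one])
  mul_smul g h p := SH.ext (mul_smul g h p.z)
    (show (j (g * h) p.z)⁻¹ ^ 2 * p.ζ = (j g (h • p.z))⁻¹ ^ 2 * ((j h p.z)⁻¹ ^ 2 * p.ζ) by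
      rw [j_mul, mul_inv, mul_pow, mul_assoc])

/-- The point `(x + iy, y e^{iφ})` of `SH` with coordinates `z = x + iy` and `φ`. -/
def SH.ofAngle (z : ℍ) (φ : ℝ) : SH :=
  ⟨(z, z.im * Complex.exp (φ * Complex.I)), by simp [abs_of_pos z.im_pos]⟩

/-- The invariant volume `dV = (dx dy / y²) (dφ / 2π)` on `SH`; the `volume` of `ℍ` in Mathlib is
the hyperbolic one, `dx dy / y²`. -/
def dV : Measure SH :=
  Measure.map (fun q : ℍ × ℝ => SH.ofAngle q.1 q.2)
    ((volume : Measure ℍ).prod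
      ((ENNReal.ofReal (2 * Real.pi))⁻¹ • volume.restrict (Set.Ioc 0 (2 * Real.pi))))

/-- The base point `I = (i, 1)` of `SH`. -/
def basePoint : SH := ⟨(UpperHalfPlane.I, 1), by simp⟩

/-- A smooth curve `G(t)` in `SL(2, ℝ)` is horizontal if `G(t)⁻¹ G'(t)` lies in the space `𝔭` of
traceless symmetric matrices for all `t`; a curve in `SH` is horizontal (for the left-invariant
connection on `SH = SL(2, ℝ)/{±1}`) if it is `t ↦ G(t) · I` for such a `G`. -/
def IsHorizontal (c : ℝ → SH) : Prop :=
  ∃ G : ℝ → SL(2, ℝ), (∀ a b, ContDiff ℝ ∞ (fun t => G t a b)) ∧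
    (∀ t, let A : Matrix (Fin 2) (Fin 2) ℝ :=
        ((G t)⁻¹ : SL(2, ℝ)) * Matrix.of (fun a b => deriv (fun s => G s a b) t)
      A.trace = 0 ∧ A.IsSymm) ∧
    ∀ t, c t = G t • basePoint

/-- `c` is a horizontal lift to `SH` of the curve `γ` in `ℍ`. -/
def IsHorizontalLift (c : ℝ → SH) (γ : ℝ → ℍ) : Prop :=
  IsHorizontal c ∧ ∀ t, (c t).z = γ t

/-- `γ : ℝ → ℍ` represents a smooth closed curve with domain `[0, T]` in `X = Γ \ ℍ` which
satisfies the Bohr-Sommerfeld condition of order `k`: for some `γ₀ ∈ Γ` one has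
`γ₀ · γ(t) = γ(t + T)`, and the holonomy `w` of the closed curve in `SX = Γ \ SH`, that is the
unit complex number that takes the class of the start of a horizontal lift `c` to the class of its
end, `[c(T)] = [w · c(0)]`, is a `k`-th root of unity. -/
def IsBS (Γ : Subgroup SL(2, ℝ)) (k : ℕ) (T : ℝ) (γ : ℝ → ℍ) : Prop :=
  0 < k ∧ 0 < T ∧ ContDiff ℝ ∞ (fun t => (γ t : ℂ)) ∧
    ∃ γ₀ ∈ Γ, (∀ t, γ₀ • γ t = γ (t + T)) ∧
      ∃ c : ℝ → SH, IsHorizontalLift c γ ∧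
        ∃ w : ℂ, w ^ k = 1 ∧ (c T).ζ = w * (γ₀ • c 0).ζ

/-- The space `𝒮_k(X)`, `X = Γ \ ℍ`, as a space of functions on `SH`: the `Γ`-invariant functions
`F(z, ζ) = ζᵏ f(z)` with `f` holomorphic on `ℍ` that are square integrable over the part of `SH`
above a fundamental domain `𝓕` of `Γ`. -/
def hardy (Γ : Subgroup SL(2, ℝ)) (𝓕 : Set ℍ) (k : ℕ) : Submodule ℂ (SH → ℂ) where
  carrier := {F | (∃ f : ℍ → ℂ, MDifferentiable 𝓘(ℂ) 𝓘(ℂ) f ∧ ∀ p, F p = p.ζ ^ k * f p.z) ∧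
    (∀ g ∈ Γ, ∀ p, F (g • p) = F p) ∧ MemLp F 2 (dV.restrict {p | p.z ∈ 𝓕})}
  zero_mem' := ⟨⟨0, mdifferentiable_const, fun p => by simp⟩, fun _ _ _ => rfl, MemLp.zero⟩
  add_mem' := by
    rintro F F' ⟨⟨f, hf, hF⟩, hi, hm⟩ ⟨⟨f', hf', hF'⟩, hi', hm'⟩
    refine ⟨⟨f + f', hf.add hf', fun p => ?_⟩, fun g hg p => ?_, hm.add hm'⟩
    · simp [hF, hF', mul_add]
    · simp [hi g hg, hi' g hg]
  smul_mem' := by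
    rintro a F ⟨⟨f, hf, hF⟩, hi, hm⟩
    refine ⟨⟨a • f, hf.const_smul a, fun p => ?_⟩, fun g hg p => ?_, hm.const_smul a⟩
    · simp [hF]; ring
    · simp [hi g hg]

/-- The inner product `∫ F \bar G dV` of `L²(SX)`, linear in the first variable. -/
def ip (𝓕 : Set ℍ) (F G : SH → ℂ) : ℂ :=
  ∫ p in {p : SH | p.z ∈ 𝓕}, F p * conj (G p) ∂dV

/-- `u` is the state `|γ, k⟩ = Π_k(δ_c)` of the curve in `X = Γ \ ℍ` with domain `[0, T]` and
horizontal lift `c`. Here `δ_c` is the delta function integrated along `c` using the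
parametrization, `⟨F, δ_c⟩ = ∫_0^T F(c(t)) dt`, and the orthogonal projection `Π_k` onto
`𝒮_k(X)`, extended by duality to distributions, takes `δ_c` to the element `u` of `𝒮_k(X)` with
`⟨F, u⟩ = ⟨F, δ_c⟩` for all `F` in `𝒮_k(X)`. -/
def IsState (Γ : Subgroup SL(2, ℝ)) (𝓕 : Set ℍ) (k : ℕ) (T : ℝ) (c : ℝ → SH) (u : SH → ℂ) :
    Prop :=
  u ∈ hardy Γ 𝓕 k ∧ ∀ F ∈ hardy Γ 𝓕 k, ip 𝓕 F u = ∫ t in (0 : ℝ)..T, F (c t)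

/-- The group `SL(2, ℤ)` as a subgroup of `SL(2, ℝ)`. -/
def modularGroup : Subgroup SL(2, ℝ) :=
  (Matrix.SpecialLinearGroup.map (n := Fin 2) (Int.castRingHom ℝ)).range

/-- The subgroup `Γ_∞` of `SL(2, ℤ)` fixing `∞`. -/
def stabInfty : Subgroup SL(2, ℤ) :=
  (MulAction.stabilizer (GL (Fin 2) ℝ) (OnePoint.infty : OnePoint ℝ)).comap
    (Matrix.SpecialLinearGroup.mapGL ℝ)

theorem mem_stabInfty {g : SL(2, ℤ)} : g ∈ stabInfty ↔ g 1 0 = 0 := by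
  simp [stabInfty, MulAction.mem_stabilizer_iff, OnePoint.smul_infty_eq_self_iff]

/-- The term `e^{2πi m (g · z)} j(g, z)^{-2k}` of the Poincaré series. -/
def poincareTerm (m k : ℕ) (z : ℍ) (g : SL(2, ℤ)) : ℂ :=
  Complex.exp (2 * Real.pi * Complex.I * m * ((g • z : ℍ) : ℂ)) / j (g : SL(2, ℝ)) z ^ (2 * k)

theorem poincareTerm_mul_left (m k : ℕ) (z : ℍ) {h : SL(2, ℤ)} (hh : h ∈ stabInfty)
    (g : SL(2, ℤ)) : poincareTerm m k z (h * g) = poincareTerm m k z g := by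
  have hc : h 1 0 = 0 := mem_stabInfty.mp hh
  have hdet : h 0 0 * h 1 1 = 1 := by
    have := h.det_coe
    rw [Matrix.det_fin_two, hc] at this
    simpa using this
  have hd : (h 1 1) ^ 2 = 1 ∧ h 0 0 = h 1 1 := by
    rcases Int.mul_eq_one_iff_eq_one_or_neg_one.mp hdet with ⟨h0, h1⟩ | ⟨h0, h1⟩ <;> simp [h0, h1]
  obtain ⟨hd2, h00⟩ := hd
  have hd2' : ((h 1 1 : ℤ) : ℂ) ^ 2 = 1 := by exact_mod_cast hd2
  have hd0 : ((h 1 1 : ℤ) : ℂ) ≠ 0 := fun h0 => by simp [h0] at hd2'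
  have hj : j ((h * g : SL(2, ℤ)) : SL(2, ℝ)) z ^ (2 * k) = j (g : SL(2, ℝ)) z ^ (2 * k) := by
    have hh : j (h : SL(2, ℝ)) ((g : SL(2, ℝ)) • z) = ((h 1 1 : ℤ) : ℂ) := by simp [j, hc]
    rw [map_mul, j_mul, hh, mul_pow, pow_mul, hd2', one_pow, one_mul]
  have he : (((h * g) • z : ℍ) : ℂ) = ((g • z : ℍ) : ℂ) + ((h 0 1 * h 1 1 : ℤ) : ℂ) := by
    have hz : ((h • (g • z) : ℍ) : ℂ) = ((h 1 1 : ℤ) * ((g • z : ℍ) : ℂ) + (h 0 1 : ℤ)) /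
        ((0 : ℤ) * ((g • z : ℍ) : ℂ) + (h 1 1 : ℤ)) := by
      have h' := coe_specialLinearGroup_apply h (g • z)
      rw [hc, h00] at h'
      exact_mod_cast h'
    rw [mul_smul, hz, Int.cast_zero, zero_mul, zero_add, div_eq_iff hd0]
    push_cast
    linear_combination (-(h 0 1 : ℂ)) * hd2'
  rw [poincareTerm, poincareTerm, hj, he, mul_add, Complex.exp_add]
  have h1 : Complex.exp (2 * Real.pi * Complex.I * m * ((h 0 1 * h 1 1 : ℤ) : ℂ)) = 1 :=
    Complex.exp_eq_one_iff.mpr ⟨m * (h 0 1 * h 1 1), by push_cast; ring⟩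
  rw [h1, mul_one]

/-- The term of the Poincaré series as a function on `Γ_∞ \ SL(2, ℤ)`. -/
def poincareCosetTerm (m k : ℕ) (z : ℍ) :
    Quotient (QuotientGroup.rightRel stabInfty) → ℂ :=
  Quotient.lift (poincareTerm m k z) (by
    intro a b hab
    have h : b * a⁻¹ ∈ stabInfty := QuotientGroup.rightRel_apply.mp hab
    simpa using (poincareTerm_mul_left m k z h a).symm)

/-- The classical Poincaré series `P_{m,k}(z) = ∑_{g ∈ Γ_∞ \ Γ} e^{2πi m (g · z)} j(g, z)^{-2k}`
for `Γ = SL(2, ℤ)`. -/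
def poincareSeries (m k : ℕ) (z : ℍ) : ℂ := ∑' q, poincareCosetTerm m k z q

end BohrSommerfeld

end

namespace BohrSommerfeld

open Set ModularGroup

/-! ### The hyperbolic measure in coordinates -/

/-! The state represents the functional F ↦ ∫ F along the lift. At the chosen height this functional
is a Fourier coefficient, and the Petersson formula says that the Poincaré series represents the
same coefficient.

Geometry: differentiating γ(t) = G(t)·i with G⁻¹G' symmetric and traceless forces every horizontal
lift of the line at height y to satisfy ζ(t) = ζ(0)e^{-it/y} (`ζ_of_isHorizontalLift`). For y =
k/(2πm), ζᵏ turns as e^{-2πimt}. Hence the holonomy e^{-2πim/k} is a k-th root of unity, and for F =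
ζᵏf the integral over [0,1] is ζ(0)ᵏe^{-k} times the m-th Fourier coefficient of f
(`integral_lift`).

Petersson formula (`ip_poincareSeries`): the translates of `fd` tile ℍ, so the sum over Γ_∞\Γ inside
⟨F, ζᵏP⟩ unfolds to one integral over the strip 0 ≤ x < 1 (`integral_unfold`). There the x-integral
is the Fourier coefficient, independent of the height by Cauchy's theorem, and the y-integral is a
Gamma value.

Analysis: on `fd` the sum of the absolute values of the terms, times yᵏ, is at most K y^{1/4}
(`exists_bound_tsum_fd`). As y^{1/4} is square integrable for dx dy/y² there, ζᵏP is in the Hardy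
space, and Cauchy–Schwarz with yᵏ|f| justifies the unfolding; no growth condition on f at the cusp
enters beyond square integrability.

Uniqueness: the inner product is definite on the Hardy space, by the identity theorem
(`eq_zero_of_ip_self`). -/

/-- The measure `dy / y²` on `(0, ∞)`. -/
noncomputable def imMeasure : Measure ℝ :=
  (volume.restrict (Ioi 0)).withDensity fun y => ENNReal.ofReal ((y ^ 2)⁻¹)

instance : SFinite imMeasure := by unfold imMeasure; infer_instance

/-- The point `x + iy` of `ℍ`, for `y > 0`. -/
noncomputable def ofCoords (p : ℝ × ℝ) : ℍ := ofComplex (p.1 + p.2 * Complex.I)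

theorem measurable_ofComplex : Measurable ofComplex := by
  refine (measurableEmbedding_coe.measurable_comp_iff).mp ?_
  -- Off the upper half plane `ofComplex` takes a single default value.
  have h : (UpperHalfPlane.coe ∘ ofComplex) =
      {z : ℂ | 0 < z.im}.piecewise id (fun _ => (ofComplex 0 : ℂ)) := by
    ext z
    by_cases hz : 0 < z.im
    · simp [hz, ofComplex_apply_of_im_pos]
    · simp [hz, ofComplex_apply_of_im_nonpos (not_lt.mp hz),
        ofComplex_apply_of_im_nonpos (le_refl (0 : ℂ).im)]
  rw [h]
  exact Measurable.piecewise (measurableSet_lt measurable_const Complex.measurable_im)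
    measurable_id measurable_const

theorem measurable_ofCoords : Measurable ofCoords :=
  measurable_ofComplex.comp (by fun_prop)

theorem coe_ofCoords {p : ℝ × ℝ} (hp : 0 < p.2) :
    (ofCoords p : ℂ) = p.1 + p.2 * Complex.I := by
  rw [ofCoords, ofComplex_apply_of_im_pos (by simpa using hp)]

theorem ofCoords_re {p : ℝ × ℝ} (hp : 0 < p.2) : (ofCoords p).re = p.1 := by
  rw [← coe_re, coe_ofCoords hp]; simp

theorem ofCoords_im {p : ℝ × ℝ} (hp : 0 < p.2) : (ofCoords p).im = p.2 := by
  rw [← coe_im, coe_ofCoords hp]; simp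

theorem prod_restrict_imMeasure (S : Set ℝ) :
    (volume.restrict S).prod imMeasure =
      ((volume : Measure (ℝ × ℝ)).restrict (S ×ˢ Ioi 0)).withDensity
        fun p => ENNReal.ofReal ((p.2 ^ 2)⁻¹) := by
  rw [imMeasure, prod_withDensity_right (by fun_prop), Measure.prod_restrict]
  rfl

/-- The default value of `ofCoords` for y ≤ 0 does no harm, because `imMeasure` lives on y > 0. -/
theorem map_ofCoords : Measure.map ofCoords ((volume : Measure ℝ).prod imMeasure) = volume := by
  ext s hs
  rw [Measure.map_apply measurable_ofCoords hs, volume_eq_lintegral,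
    ← Measure.restrict_univ (μ := (volume : Measure ℝ)), prod_restrict_imMeasure,
    withDensity_apply _ (measurable_ofCoords hs), Measure.restrict_restrict
      (measurable_ofCoords hs),
    ← Complex.volume_preserving_equiv_real_prod.setLIntegral_comp_preimage_emb
      Complex.measurableEquivRealProd.measurableEmbedding]
  have h : Complex.measurableEquivRealProd ⁻¹' (ofCoords ⁻¹' s ∩ univ ×ˢ Ioi 0) =
      UpperHalfPlane.coe '' s := by
    ext z
    simp only [ofCoords, mem_preimage, mem_inter_iff, mem_prod, mem_univ, mem_Ioi, true_and,
      Complex.measurableEquivRealProd_apply, Complex.re_add_im, mem_image]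
    constructor
    · rintro ⟨h1, h2⟩
      exact ⟨_, h1, by rw [ofComplex_apply_of_im_pos h2]⟩
    · rintro ⟨w, hw, rfl⟩
      exact ⟨by rwa [ofComplex_apply], w.im_pos⟩
  rw [h]
  refine lintegral_congr fun z => ?_
  simp only [Complex.measurableEquivRealProd_apply]
  rw [ENNReal.ofReal]
  congr 1
  ext
  simp [sq_nonneg]

/-- Used with S = [0,1) for the unfolded integral and with S = [-1/2,1/2] for integrability on `fd`.
-/
theorem map_ofCoords_restrict {S : Set ℝ} (hS : MeasurableSet S) :
    Measure.map ofCoords ((volume.restrict S).prod imMeasure) =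
      (volume : Measure ℍ).restrict {z | z.re ∈ S} := by
  have hm : MeasurableSet {z : ℍ | z.re ∈ S} :=
    (continuous_re.measurable) hS
  rw [← map_ofCoords, Measure.restrict_map measurable_ofCoords hm]
  congr 1
  rw [imMeasure, prod_withDensity_right (by fun_prop), prod_withDensity_right (by fun_prop),
    restrict_withDensity (measurable_ofCoords hm)]
  congr 1
  have h : (volume : Measure ℝ).prod ((volume : Measure ℝ).restrict (Ioi 0)) =
      ((volume : Measure ℝ).prod volume).restrict (univ ×ˢ Ioi 0) := by
    rw [← Measure.prod_restrict, Measure.restrict_univ]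
  rw [h, Measure.prod_restrict, Measure.restrict_restrict (measurable_ofCoords hm)]
  congr 1
  ext p
  simp only [mem_prod, mem_Ioi, mem_inter_iff, mem_preimage, mem_ofPred_eq, mem_univ, true_and]
  exact ⟨fun h => ⟨by rw [ofCoords_re h.2]; exact h.1, h.2⟩,
    fun h => ⟨by have := h.1; rwa [ofCoords_re h.2] at this, h.2⟩⟩

/-! ### The boundary of the fundamental domain and the tiling -/

theorem volume_eq_zero_of_coe {s : Set ℍ} (h : volume (UpperHalfPlane.coe '' s) = 0) :
    volume s = 0 := by
  rw [volume_eq_lintegral, setLIntegral_measure_zero _ _ h]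

theorem volume_re_eq (a : ℝ) : volume {z : ℂ | z.re = a} = 0 := by
  have h : {z : ℂ | z.re = a} = Complex.measurableEquivRealProd ⁻¹' ({a} ×ˢ univ) := by
    ext z; simp
  rw [h, Complex.volume_preserving_equiv_real_prod.measure_preimage_equiv,
    Measure.volume_eq_prod, Measure.prod_prod]
  simp

/-- The boundary lies on the unit circle and two vertical lines. -/
theorem volume_fd_diff_fdo : volume (fd \ fdo) = 0 := by
  refine volume_eq_zero_of_coe (measure_mono_null (t := Metric.sphere (0 : ℂ) 1 ∪
    ({z : ℂ | z.re = 1 / 2} ∪ {z : ℂ | z.re = -(1 / 2)})) ?_ ?_)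
  · rintro _ ⟨z, ⟨⟨h1, h2⟩, h3⟩, rfl⟩
    by_cases h4 : |z.re| < 1 / 2
    · left
      have h5 : ¬ (1 < Complex.normSq z) := fun h => h3 ⟨h, h4⟩
      have h6 : Complex.normSq z = 1 := le_antisymm (not_lt.mp h5) h1
      rw [Complex.normSq_eq_norm_sq] at h6
      simpa using (pow_eq_one_iff_of_nonneg (norm_nonneg _) two_ne_zero).mp h6
    · right
      have h5 : |z.re| = 1 / 2 := le_antisymm h2 (not_lt.mp h4)
      rcases (abs_eq (by norm_num)).mp h5 with h | h
      · left; simpa using h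
      · right; simpa using h
  · exact measure_union_null (Measure.addHaar_sphere _ _ _)
      (measure_union_null (volume_re_eq _) (volume_re_eq _))

theorem measurableSet_fd : MeasurableSet fd := isClosed_fd.measurableSet

theorem measurePreserving_smul_int (g : SL(2, ℤ)) :
    MeasurePreserving (fun z : ℍ => g • z) volume volume :=
  measurePreserving_smul (Matrix.SpecialLinearGroup.mapGL ℝ g) (volume : Measure ℍ)

theorem volume_fd_inter_smul {g : SL(2, ℤ)} (h1 : g ≠ 1) (h2 : g ≠ -1) :
    volume (fd ∩ (fun z : ℍ => g • z) ⁻¹' fd) = 0 := by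
  refine measure_mono_null (t := (fd \ fdo)) ?_ volume_fd_diff_fdo
  rintro z ⟨hz, hgz⟩
  refine ⟨hz, fun h => ?_⟩
  rcases eq_one_or_neg_one_of_mem_fdo_mem_fd h hgz with h | h
  exacts [h1 h, h2 h]

/-- A family of elements of `SL(2, ℤ)` representing the classes modulo `± 1`. -/
structure IsProjectiveSystem {ι : Type*} (γ : ι → SL(2, ℤ)) : Prop where
  inj : ∀ i i', γ i = γ i' ∨ γ i = -γ i' → i = i'
  surj : ∀ g, ∃ i, γ i = g ∨ γ i = -g

/-- The translates of `fd` by the `γ i` cover ℍ and meet only in null sets. Each piece of A is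
carried back into `fd` by the measure-preserving `(γ i)⁻¹`. -/
theorem IsProjectiveSystem.volume_eq_tsum {ι : Type*} [Countable ι] {γ : ι → SL(2, ℤ)}
    (h : IsProjectiveSystem γ) {A : Set ℍ} (hA : MeasurableSet A) :
    volume A = ∑' i, volume (fd ∩ (fun z : ℍ => γ i • z) ⁻¹' A) := by
  have key : ∀ i, volume (fd ∩ (fun z : ℍ => γ i • z) ⁻¹' A) =
      volume ((fun z : ℍ => (γ i)⁻¹ • z) ⁻¹' fd ∩ A) := fun i => by
    rw [← (measurePreserving_smul_int (γ i)).measure_preimage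
      (((measurePreserving_smul_int (γ i)⁻¹).measurable measurableSet_fd).inter
        hA).nullMeasurableSet]
    congr 1
    ext z
    simp
  simp_rw [key]
  rw [← measure_iUnion₀]
  · congr 1
    rw [← iUnion_inter, eq_comm, inter_eq_right]
    intro z _
    obtain ⟨g, hg⟩ := exists_smul_mem_fd z
    obtain ⟨i, hi⟩ := h.surj g⁻¹
    refine mem_iUnion.mpr ⟨i, ?_⟩
    rcases hi with hi | hi
    · simpa [hi] using hg
    · simpa [hi, inv_neg] using hg
  · intro i i' hne
    refine measure_mono_null (t := (fun z : ℍ => (γ i)⁻¹ • z) ⁻¹' (fd ∩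
      (fun z : ℍ => ((γ i')⁻¹ * γ i) • z) ⁻¹' fd)) ?_ ?_
    · rintro z ⟨⟨h1, -⟩, h2, -⟩
      refine ⟨h1, ?_⟩
      simpa [mul_smul] using h2
    · rw [(measurePreserving_smul_int _).measure_preimage
        (measurableSet_fd.inter ((measurePreserving_smul_int _).measurable
          measurableSet_fd)).nullMeasurableSet]
      refine volume_fd_inter_smul (fun h1 => hne (h.inj _ _ (.inl ?_)))
        (fun h1 => hne (h.inj _ _ (.inr ?_)))
      · rw [inv_mul_eq_one] at h1; exact h1.symm
      · rw [inv_mul_eq_iff_eq_mul] at h1; simpa using h1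
  · intro i
    exact (((measurePreserving_smul_int (γ i)⁻¹).measurable measurableSet_fd).inter
        hA).nullMeasurableSet

end BohrSommerfeld

namespace BohrSommerfeld

open Set ModularGroup

/-! ### Unfolding -/

/-- The coset space `Γ_∞ \ SL(2, ℤ)`. -/
abbrev CuspCosets : Type := Quotient (QuotientGroup.rightRel stabInfty)

instance : Countable SL(2, ℤ) :=
  Function.Injective.countable (f := fun g : SL(2, ℤ) => fun i i' => g i i')
    fun _ _ h => Matrix.SpecialLinearGroup.ext _ _ fun i i' => congrFun (congrFun h i) i'

instance : Countable CuspCosets := inferInstanceAs (Countable (Quotient _))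

theorem out_mul_inv_mem (g : SL(2, ℤ)) :
    g * (Quotient.out (s := QuotientGroup.rightRel stabInfty) ⟦g⟧)⁻¹ ∈ stabInfty :=
  QuotientGroup.rightRel_apply.mp (Quotient.mk_out (s := QuotientGroup.rightRel stabInfty) g)

theorem cuspCosets_eq_of_out {q q' : CuspCosets} (h : q'.out * q.out⁻¹ ∈ stabInfty) : q = q' := by
  rw [← Quotient.out_eq q, ← Quotient.out_eq q']
  exact Quotient.sound (QuotientGroup.rightRel_apply.mpr h)

theorem T_zpow_mem_stabInfty (n : ℤ) : T ^ n ∈ stabInfty := by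
  simp [mem_stabInfty, coe_T_zpow]

theorem neg_mem_stabInfty {g : SL(2, ℤ)} (hg : g ∈ stabInfty) : -g ∈ stabInfty := by
  rw [mem_stabInfty] at *; simp [hg]

theorem exists_eq_T_zpow_of_mem_stabInfty {g : SL(2, ℤ)} (hg : g ∈ stabInfty) :
    ∃ n : ℤ, T ^ n = g ∨ T ^ n = -g := by
  have hc : g 1 0 = 0 := mem_stabInfty.mp hg
  have had := g.det_coe
  rw [Matrix.det_fin_two, hc] at had
  have had' : g 0 0 * g 1 1 = 1 := by simpa using had
  rcases Int.mul_eq_one_iff_eq_one_or_neg_one.mp had' with ⟨ha, hd⟩ | ⟨ha, hd⟩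
  · refine ⟨g 0 1, .inl ?_⟩
    ext i j; fin_cases i <;> fin_cases j <;> simp [ha, hc, hd, coe_T_zpow]
  · refine ⟨-g 0 1, .inr ?_⟩
    ext i j; fin_cases i <;> fin_cases j <;> simp [ha, hc, hd, coe_T_zpow]

/-- Γ_∞ consists of the ±Tⁿ, so modulo sign every element is a unique power of T times a coset
representative. -/
theorem isProjectiveSystem_cuspCosets :
    IsProjectiveSystem fun p : ℤ × CuspCosets => T ^ p.1 * p.2.out where
  inj := by
    rintro ⟨n, q⟩ ⟨n', q'⟩ h
    have h1 : T ^ n * q.out * q'.out⁻¹ ∈ stabInfty := by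
      rcases h with h | h
      · simpa [show T ^ n * q.out = T ^ n' * q'.out from h] using T_zpow_mem_stabInfty n'
      · have := neg_mem_stabInfty (T_zpow_mem_stabInfty n')
        simpa [show T ^ n * q.out = -(T ^ n' * q'.out) from h] using this
    have h2 : q.out * q'.out⁻¹ ∈ stabInfty := by
      have := stabInfty.mul_mem (T_zpow_mem_stabInfty (-n)) h1
      rwa [mul_assoc, ← mul_assoc, ← zpow_add, neg_add_cancel, zpow_zero, one_mul] at this
    obtain rfl : q' = q := cuspCosets_eq_of_out h2
    have h3 : T ^ n = T ^ n' ∨ T ^ n = -T ^ n' := by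
      refine h.imp (fun h => mul_right_cancel h) fun h => ?_
      exact mul_right_cancel (b := q'.out) (by simpa using h)
    have e : ∀ l i i', (T ^ l : SL(2, ℤ)) i i' = (!![1, l; 0, 1] : Matrix _ _ ℤ) i i' :=
      fun l i i' => by rw [coe_T_zpow]
    rcases h3 with h3 | h3
    · have h4 := congrArg (fun g : SL(2, ℤ) => g 0 1) h3
      simp only [e] at h4
      simpa using h4
    -- The opposite sign would give 1 = -1 in the upper left entry.
    · have h4 := congrArg (fun g : SL(2, ℤ) => g 0 0) h3
      simp only [Matrix.SpecialLinearGroup.coe_neg, Matrix.neg_apply, e] at h4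
      simp at h4
  surj g := by
    obtain ⟨n, hn⟩ := exists_eq_T_zpow_of_mem_stabInfty (out_mul_inv_mem g)
    refine ⟨(n, ⟦g⟧), hn.imp (fun h => ?_) fun h => ?_⟩
    · simp [h]
    · simp [h]

/-- The strip `0 ≤ x < 1` in `ℍ`. -/
def strip : Set ℍ := {z | z.re ∈ Ico (0 : ℝ) 1}

theorem measurableSet_strip : MeasurableSet strip := continuous_re.measurable measurableSet_Ico

/-- The translate of `z` that lies in the strip `0 ≤ x < 1`. -/
noncomputable def toStrip (z : ℍ) : ℍ := T ^ (-⌊z.re⌋) • z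

theorem measurable_toStrip : Measurable toStrip := by
  refine (measurableEmbedding_coe.measurable_comp_iff).mp ?_
  have h : UpperHalfPlane.coe ∘ toStrip = fun z : ℍ => (z : ℂ) + ((((-⌊z.re⌋ : ℤ) : ℝ)) : ℂ) := by
    ext z
    rw [Function.comp_apply, toStrip, coe_T_zpow_smul_eq]
    norm_cast
  rw [h]
  have h2 : Measurable fun z : ℍ => z.re := continuous_re.measurable
  fun_prop

theorem toStrip_eq_iff {z w : ℍ} {n : ℤ} (hw : w ∈ strip) (h : T ^ n • z = w) :
    toStrip z = w := by
  have h1 := congrArg UpperHalfPlane.re h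
  rw [re_T_zpow_smul] at h1
  have h2 : ⌊z.re⌋ = -n := by
    rw [Int.floor_eq_iff]
    have := hw.1
    have := hw.2
    push_cast
    constructor <;> linarith
  rw [toStrip, h2, neg_neg, h]

theorem toStrip_mem (z : ℍ) : toStrip z ∈ strip := by
  have h1 := Int.floor_le z.re
  have h2 := Int.lt_floor_add_one z.re
  have h3 : (toStrip z).re = z.re + (-⌊z.re⌋ : ℤ) := re_T_zpow_smul z _
  simp only [strip, mem_ofPred_eq, mem_Ico, h3]
  push_cast
  constructor <;> linarith

/-- The measure on `ℍ` whose integrals are the integrals over `fd` of the sums over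
`Γ_∞ \ SL(2, ℤ)`. -/
noncomputable def cosetMeasure : Measure ℍ :=
  Measure.sum fun q : CuspCosets =>
    Measure.map (fun z : ℍ => q.out • z) ((volume : Measure ℍ).restrict fd)

/-- Unfolding at the level of measures. The tiling splits the strip over pairs (n, q). For fixed q
and z exactly one n brings Tⁿqz into the strip, so the sum over n reassembles a preimage under
`toStrip`. -/
theorem map_toStrip_cosetMeasure :
    Measure.map toStrip cosetMeasure = (volume : Measure ℍ).restrict strip := by
  ext s hs
  have hms : ∀ (g : SL(2, ℤ)) {A : Set ℍ}, MeasurableSet A →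
      MeasurableSet ((fun z : ℍ => g • z) ⁻¹' A) :=
    fun g A hA => (measurePreserving_smul_int g).measurable hA
  rw [Measure.map_apply measurable_toStrip hs, cosetMeasure,
    Measure.sum_apply _ (measurable_toStrip hs), Measure.restrict_apply hs,
    isProjectiveSystem_cuspCosets.volume_eq_tsum (hs.inter measurableSet_strip),
    ENNReal.tsum_prod', ENNReal.tsum_comm]
  refine tsum_congr fun q => ?_
  rw [Measure.map_apply (measurePreserving_smul_int _).measurable (measurable_toStrip hs),
    Measure.restrict_apply (hms _ (measurable_toStrip hs)), ← measure_iUnion]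
  · congr 1
    ext z
    simp only [mem_inter_iff, mem_preimage, mem_iUnion]
    constructor
    · rintro ⟨h1, h2⟩
      exact ⟨_, h2, by rw [mul_smul]; exact ⟨h1, toStrip_mem _⟩⟩
    · rintro ⟨n, h2, h1, h3⟩
      refine ⟨?_, h2⟩
      rw [mul_smul] at h1 h3
      rwa [toStrip_eq_iff h3 rfl]
  · intro n n' hne
    refine Set.disjoint_left.mpr ?_
    rintro z ⟨-, -, h1⟩ ⟨-, -, h2⟩
    refine hne ?_
    simp only [mul_smul] at h1 h2
    simp only [strip, mem_ofPred_eq, re_T_zpow_smul, mem_Ico] at h1 h2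
    have h3 : (n : ℝ) < n' + 1 := by linarith
    have h4 : (n' : ℝ) < n + 1 := by linarith
    have h5 : n < n' + 1 := by exact_mod_cast h3
    have h6 : n' < n + 1 := by exact_mod_cast h4
    omega
  · exact fun n => measurableSet_fd.inter (hms _ (hs.inter measurableSet_strip))

theorem lintegral_unfold {φ : ℍ → ENNReal} (hφ : Measurable φ)
    (hT : ∀ (n : ℤ) z, φ (T ^ n • z) = φ z) :
    ∫⁻ z in fd, ∑' q : CuspCosets, φ (q.out • z) = ∫⁻ z in strip, φ z := by
  rw [← map_toStrip_cosetMeasure, lintegral_map hφ measurable_toStrip]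
  simp only [toStrip, hT]
  rw [cosetMeasure, lintegral_sum_measure, lintegral_tsum]
  · refine tsum_congr fun q => ?_
    rw [lintegral_map hφ (measurePreserving_smul_int _).measurable]
  · exact fun q => (hφ.comp (measurePreserving_smul_int _).measurable).aemeasurable

/-- Finiteness over the strip unfolds back to `fd`; it gives integrability for `cosetMeasure` and
the exchange of sum and integral. -/
theorem integral_unfold {φ : ℍ → ℂ} (hφ : Measurable φ) (hT : ∀ (n : ℤ) z, φ (T ^ n • z) = φ z)
    (hfin : ∫⁻ z in strip, ‖φ z‖ₑ ≠ ⊤) :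
    ∫ z in fd, ∑' q : CuspCosets, φ (q.out • z) = ∫ z in strip, φ z := by
  have hmq : ∀ q : CuspCosets, Measurable fun z : ℍ => φ (q.out • z) :=
    fun q => hφ.comp (measurePreserving_smul_int _).measurable
  have hfin' : ∫⁻ z in fd, ∑' q : CuspCosets, ‖φ (q.out • z)‖ₑ ≠ ⊤ := by
    rwa [lintegral_unfold (φ := fun z => ‖φ z‖ₑ) hφ.enorm (fun n z => by simp only [hT])]
  have hint : Integrable φ cosetMeasure := by
    refine ⟨hφ.aestronglyMeasurable, ?_⟩
    rw [HasFiniteIntegral, cosetMeasure, lintegral_sum_measure, lt_top_iff_ne_top]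
    convert hfin' using 1
    rw [lintegral_tsum fun q => (hmq q).enorm.aemeasurable]
    refine tsum_congr fun q => ?_
    rw [lintegral_map hφ.enorm (measurePreserving_smul_int _).measurable]
  rw [← map_toStrip_cosetMeasure,
    integral_map measurable_toStrip.aemeasurable hφ.aestronglyMeasurable]
  simp only [toStrip, hT]
  rw [cosetMeasure] at hint ⊢
  rw [integral_sum_measure hint, integral_tsum fun q => (hmq q).aestronglyMeasurable]
  · refine tsum_congr fun q => ?_
    rw [integral_map (measurePreserving_smul_int _).measurable.aemeasurable
      hφ.aestronglyMeasurable]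
  · rwa [← lintegral_tsum fun q => (hmq q).enorm.aemeasurable]

end BohrSommerfeld

namespace BohrSommerfeld

open Set ModularGroup

/-! ### Bounds for the terms of the Poincaré series -/

theorem j_int (g : SL(2, ℤ)) (z : ℍ) : j (g : SL(2, ℝ)) z = (g 1 0 : ℂ) * z + (g 1 1 : ℂ) := by
  simp [j]

theorem im_smul_int (g : SL(2, ℤ)) (z : ℍ) :
    (g • z).im = z.im / ‖j (g : SL(2, ℝ)) z‖ ^ 2 := by
  rw [show g • z = (g : SL(2, ℝ)) • z from rfl, im_smul_eq]
  field_simp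

theorem norm_j_int_pos (g : SL(2, ℤ)) (z : ℍ) : 0 < ‖j (g : SL(2, ℝ)) z‖ :=
  norm_pos_iff.mpr (j_ne_zero _ _)

theorem norm_cexp_two_pi_I_mul (m : ℕ) (w : ℂ) :
    ‖Complex.exp (2 * Real.pi * Complex.I * m * w)‖ = Real.exp (-(2 * Real.pi * m * w.im)) := by
  rw [Complex.norm_exp]
  congr 1
  have : 2 * Real.pi * Complex.I * m * w = ((2 * Real.pi * m : ℝ) : ℂ) * (Complex.I * w) := by
    push_cast; ring
  rw [this, Complex.re_ofReal_mul, Complex.I_mul_re]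
  ring

theorem norm_poincareTerm (m k : ℕ) (z : ℍ) (g : SL(2, ℤ)) :
    ‖poincareTerm m k z g‖ =
      Real.exp (-(2 * Real.pi * m * (g • z).im)) / ‖j (g : SL(2, ℝ)) z‖ ^ (2 * k) := by
  rw [poincareTerm, norm_div, norm_pow, norm_cexp_two_pi_I_mul, coe_im]

theorem im_pow_mul_norm_poincareTerm (m k : ℕ) (z : ℍ) (g : SL(2, ℤ)) :
    z.im ^ k * ‖poincareTerm m k z g‖ =
      (g • z).im ^ k * Real.exp (-(2 * Real.pi * m * (g • z).im)) := by
  rw [norm_poincareTerm]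
  generalize Real.exp _ = e
  rw [im_smul_int, div_pow, ← pow_mul]
  ring

theorem poincareCosetTerm_eq (m k : ℕ) (z : ℍ) (q : CuspCosets) :
    poincareCosetTerm m k z q = poincareTerm m k z q.out := by
  conv_lhs => rw [← Quotient.out_eq q]
  rfl

/-- The lower row of the chosen representative of a class in `Γ_∞ \ SL(2, ℤ)`. -/
noncomputable def lowerRow (q : CuspCosets) : Fin 2 → ℤ := q.out 1

/-- If g and g' have the same lower row (c, d), the lower left entry of g'g⁻¹ is cd - dc = 0. -/
theorem lowerRow_injective : Function.Injective lowerRow := by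
  intro q q' h
  refine cuspCosets_eq_of_out (mem_stabInfty.mpr ?_)
  have h0 : q.out 1 0 = q'.out 1 0 := congrFun h 0
  have h1 : q.out 1 1 = q'.out 1 1 := congrFun h 1
  simp [Matrix.mul_apply, Fin.sum_univ_two, Matrix.adjugate_fin_two, h0, h1]
  ring

theorem summable_lowerRow_rpow {s : ℝ} (hs : 2 < s) :
    Summable fun q : CuspCosets => ‖lowerRow q‖ ^ (-s) :=
  (EisensteinSeries.summable_one_div_norm_rpow hs).comp_injective lowerRow_injective

theorem norm_j_out_rpow_le {A B : ℝ} (hB : 0 < B) {z : ℍ} (hz : z ∈ verticalStrip A B) {s : ℝ}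
    (hs : 0 ≤ s) (q : CuspCosets) :
    ‖j (q.out : SL(2, ℝ)) z‖ ^ (-s) ≤
      EisensteinSeries.r ⟨⟨A, B⟩, hB⟩ ^ (-s) * ‖lowerRow q‖ ^ (-s) := by
  rw [j_int]
  exact EisensteinSeries.summand_bound_of_mem_verticalStrip hs (lowerRow q) hB hz

/-- Since Im(g·z) > 0 the exponential has modulus at most 1, and an Eisenstein series is a majorant,
uniformly on vertical strips. -/
theorem norm_poincareCosetTerm_le (m k : ℕ) {A B : ℝ} (hB : 0 < B) {z : ℍ}
    (hz : z ∈ verticalStrip A B) (q : CuspCosets) :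
    ‖poincareCosetTerm m k z q‖ ≤
      EisensteinSeries.r ⟨⟨A, B⟩, hB⟩ ^ (-(2 * k : ℝ)) * ‖lowerRow q‖ ^ (-(2 * k : ℝ)) := by
  refine le_trans ?_ (norm_j_out_rpow_le hB hz (by positivity) q)
  rw [poincareCosetTerm_eq, norm_poincareTerm, Real.rpow_neg (norm_nonneg _),
    show (2 * k : ℝ) = ((2 * k : ℕ) : ℝ) by push_cast; rfl, Real.rpow_natCast, div_eq_mul_inv]
  refine mul_le_of_le_one_left (by positivity) (Real.exp_le_one_iff.mpr ?_)
  have := (q.out • z).im_pos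
  simp only [Left.neg_nonpos_iff]
  positivity

theorem summable_poincare_bound {k : ℕ} (hk : 2 ≤ k) (c : ℝ) :
    Summable fun q : CuspCosets => c * ‖lowerRow q‖ ^ (-(2 * k : ℝ)) := by
  refine (summable_lowerRow_rpow ?_).mul_left c
  have : (2 : ℝ) ≤ k := by exact_mod_cast hk
  linarith

theorem mem_verticalStrip_self (z : ℍ) : z ∈ verticalStrip |z.re| z.im := ⟨le_rfl, le_rfl⟩

theorem summable_norm_poincareCosetTerm (m : ℕ) {k : ℕ} (hk : 2 ≤ k) (z : ℍ) :
    Summable fun q => ‖poincareCosetTerm m k z q‖ :=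
  Summable.of_nonneg_of_le (fun _ => norm_nonneg _)
    (fun q => norm_poincareCosetTerm_le m k z.im_pos (mem_verticalStrip_self z) q)
    (summable_poincare_bound hk _)

theorem mdifferentiable_poincareTerm (m k : ℕ) (g : SL(2, ℤ)) :
    MDifferentiable 𝓘(ℂ) 𝓘(ℂ) fun z => poincareTerm m k z g := by
  set g' : GL (Fin 2) ℝ := Matrix.SpecialLinearGroup.mapGL ℝ g with hg'
  have hdet : 0 < g'.det.val := by simp [hg']
  have h1 : MDifferentiable 𝓘(ℂ) 𝓘(ℂ) fun z : ℍ => ((g' • z : ℍ) : ℂ) :=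
    mdifferentiable_coe.comp (mdifferentiable_smul hdet)
  have h2 : MDifferentiable 𝓘(ℂ) 𝓘(ℂ) fun z : ℍ => denom g' z ^ (-(2 * k : ℤ)) :=
    mdifferentiable_denom_zpow g' _
  have h3 : Differentiable ℂ fun w : ℂ => Complex.exp (2 * Real.pi * Complex.I * m * w) := by
    fun_prop
  have h4 := (h3.mdifferentiable.comp h1).mul h2
  have h5 : (fun z => poincareTerm m k z g) = (((fun w : ℂ =>
      Complex.exp (2 * Real.pi * Complex.I * m * w)) ∘ fun z : ℍ => ((g' • z : ℍ) : ℂ)) *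
      fun z : ℍ => denom g' z ^ (-(2 * k : ℤ))) := by
    funext z
    rw [Pi.mul_apply, zpow_neg, ← div_eq_mul_inv, poincareTerm, j_eq_denom]
    norm_cast
  rw [h5]
  exact h4

theorem mdifferentiable_poincareSeries (m : ℕ) {k : ℕ} (hk : 2 ≤ k) :
    MDifferentiable 𝓘(ℂ) 𝓘(ℂ) (poincareSeries m k) := by
  rw [UpperHalfPlane.mdifferentiable_iff]
  intro w hw
  have hw' : 0 < w.im := hw
  -- A neighbourhood of w inside one vertical strip, so that the Weierstrass test applies uniformly.
  set A := |w.re| + 1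
  set B := w.im / 2
  have hB : 0 < B := by positivity
  set U : Set ℂ := {v | |v.re| < A ∧ B < v.im}
  have hU : IsOpen U := (isOpen_lt (f := fun v : ℂ => |v.re|) (by fun_prop) continuous_const).inter
    (isOpen_lt continuous_const Complex.continuous_im)
  have hUim : ∀ v ∈ U, 0 < v.im := fun v hv => hB.trans hv.2
  have key : DifferentiableOn ℂ
      (fun v => ∑' q : CuspCosets, poincareCosetTerm m k (ofComplex v) q) U := by
    refine Complex.differentiableOn_tsum_of_summable_norm (summable_poincare_bound hk
      (EisensteinSeries.r ⟨⟨A, B⟩, hB⟩ ^ (-(2 * k : ℝ)))) (fun q => ?_) hU (fun q v hv => ?_)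
    · simp only [poincareCosetTerm_eq]
      exact ((UpperHalfPlane.mdifferentiable_iff.mp
        (mdifferentiable_poincareTerm m k q.out))).mono hUim
    · refine norm_poincareCosetTerm_le m k hB ?_ q
      rw [ofComplex_apply_of_im_pos (hUim v hv)]
      exact ⟨hv.1.le, hv.2.le⟩
  have hwU : w ∈ U := ⟨by simp [A], by simp only [B]; linarith⟩
  exact ((key.differentiableAt (hU.mem_nhds hwU))).differentiableWithinAt

/-! ### Automorphy -/

theorem poincareTerm_smul (m k : ℕ) (z : ℍ) (g h : SL(2, ℤ)) :
    poincareTerm m k (h • z) g = j (h : SL(2, ℝ)) z ^ (2 * k) * poincareTerm m k z (g * h) := by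
  have h1 := j_ne_zero (h : SL(2, ℝ)) z
  have h2 := j_ne_zero (g : SL(2, ℝ)) ((h : SL(2, ℝ)) • z)
  rw [poincareTerm, poincareTerm, map_mul, j_mul, mul_smul, mul_pow,
    show (h • z) = (h : SL(2, ℝ)) • z from rfl]
  field_simp

/-- Right translation by `h` on `Γ_∞ \ SL(2, ℤ)`. -/
noncomputable def cuspCosetsMulRight (h : SL(2, ℤ)) : CuspCosets ≃ CuspCosets :=
  Quotient.congr (Equiv.mulRight h) fun a b => by
    change QuotientGroup.rightRel stabInfty a b ↔
      QuotientGroup.rightRel stabInfty (a * h) (b * h)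
    rw [QuotientGroup.rightRel_apply, QuotientGroup.rightRel_apply]
    simp [mul_assoc]

/-- The cocycle relation for j turns the action of h into right translation, which permutes the
cosets. -/
theorem poincareSeries_smul (m k : ℕ) (z : ℍ) (h : SL(2, ℤ)) :
    poincareSeries m k (h • z) = j (h : SL(2, ℝ)) z ^ (2 * k) * poincareSeries m k z := by
  rw [poincareSeries, poincareSeries, ← tsum_mul_left,
    ← (cuspCosetsMulRight h).tsum_eq (fun q => _ * poincareCosetTerm m k z q)]
  refine tsum_congr fun q => ?_
  induction q using Quotient.inductionOn with
  | h g => exact poincareTerm_smul m k z g h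

/-! ### Bounds on the fundamental domain -/

theorem half_le_im_of_mem_fd {z : ℍ} (hz : z ∈ fd) : 1 / 2 ≤ z.im := by
  have := three_le_four_mul_im_sq_of_mem_fd hz
  have := z.im_pos
  nlinarith

theorem half_le_rpow {y : ℝ} (hy : 1 / 2 ≤ y) : 1 / 2 ≤ y ^ (1 / 4 : ℝ) := by
  calc (1 / 2 : ℝ) = (1 / 2) ^ (1 : ℝ) := by simp
    _ ≤ (1 / 2) ^ (1 / 4 : ℝ) :=
      Real.rpow_le_rpow_of_exponent_ge (by norm_num) (by norm_num) (by norm_num)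
    _ ≤ y ^ (1 / 4 : ℝ) := Real.rpow_le_rpow (by norm_num) hy (by norm_num)

theorem pow_mul_exp_neg_le {m : ℕ} (hm : 1 ≤ m) (n : ℕ) {y : ℝ} (hy : 0 ≤ y) :
    y ^ n * Real.exp (-(2 * Real.pi * m * y)) ≤ n.factorial := by
  have h1 : Real.exp (-(2 * Real.pi * m * y)) ≤ Real.exp (-y) := by
    refine Real.exp_le_exp.mpr (neg_le_neg (le_mul_of_one_le_left hy ?_))
    have h2 : (1 : ℝ) ≤ m := by exact_mod_cast hm
    nlinarith [Real.pi_gt_three]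
  have h3 := Real.pow_div_factorial_le_exp y hy n
  rw [div_le_iff₀ (by positivity)] at h3
  calc y ^ n * Real.exp (-(2 * Real.pi * m * y)) ≤ (Real.exp y * n.factorial) * Real.exp (-y) := by
        gcongr
    _ = n.factorial := by rw [mul_right_comm, ← Real.exp_add]; simp

/-- The trivial coset (c = 0) is bounded by the exponential decay. When c ≠ 0, |cz + d| ≥ y lets
part of the decay in |cz + d| be traded for powers of y, keeping enough for summability over lower
rows. -/
theorem exists_bound_term_fd {m k : ℕ} (hm : 1 ≤ m) (hk : 2 ≤ k) :
    ∃ K : ℝ, ∀ z ∈ fd, ∀ q : CuspCosets, (q.out • z).im ^ k *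
      Real.exp (-(2 * Real.pi * m * (q.out • z).im)) ≤
        z.im ^ (1 / 4 : ℝ) * (K * ‖lowerRow q‖ ^ (-(9 / 4) : ℝ)) := by
  have hB : (0 : ℝ) < 1 / 2 := by norm_num
  set R : ℝ := EisensteinSeries.r ⟨⟨1 / 2, 1 / 2⟩, hB⟩ ^ (-(9 / 4) : ℝ)
  have hR : 0 ≤ R := Real.rpow_nonneg (EisensteinSeries.r_pos _).le _
  -- The two summands serve c = 0 and c ≠ 0; the 2 compensates y^{1/4} ≥ 1/2.
  refine ⟨2 * k.factorial + (k - 2).factorial * R, fun z hz q => ?_⟩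
  have hy := half_le_im_of_mem_fd hz
  have hy4 := half_le_rpow hy
  have hy0 := z.im_pos
  have hn : 0 ≤ ‖lowerRow q‖ ^ (-(9 / 4) : ℝ) := Real.rpow_nonneg (norm_nonneg _) _
  by_cases hc : q.out 1 0 = 0
  · have hd : |q.out 1 1| = 1 := by
      have had := q.out.det_coe
      rw [Matrix.det_fin_two, hc] at had
      rcases Int.mul_eq_one_iff_eq_one_or_neg_one.mp (by simpa using had) with h | h <;>
        simp [h.2]
    have hrow : ‖lowerRow q‖ = 1 := by
      rw [EisensteinSeries.norm_eq_max_natAbs]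
      simp only [lowerRow, hc]
      have : (q.out 1 1).natAbs = 1 := by
        rw [Int.abs_eq_natAbs] at hd
        exact_mod_cast hd
      simp [this]
    rw [hrow, Real.one_rpow]
    have h1 := pow_mul_exp_neg_le hm k (q.out • z).im_pos.le
    have h2 : (0 : ℝ) ≤ (k - 2).factorial * R := by positivity
    have h3 : (0 : ℝ) ≤ k.factorial := by positivity
    nlinarith
  · have hyj : z.im ≤ ‖j (q.out : SL(2, ℝ)) z‖ := by
      have h1 : |(j (q.out : SL(2, ℝ)) z).im| ≤ ‖j (q.out : SL(2, ℝ)) z‖ := Complex.abs_im_le_norm _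
      have h2 : (j (q.out : SL(2, ℝ)) z).im = q.out 1 0 * z.im := by
        rw [j_int]; simp
      have h3 : (1 : ℝ) ≤ |(q.out 1 0 : ℝ)| := by exact_mod_cast Int.one_le_abs hc
      rw [h2, abs_mul, abs_of_pos hy0] at h1
      nlinarith
    have hj := norm_j_int_pos q.out z
    have hbd := norm_j_out_rpow_le hB (z := z) ⟨hz.2, hy⟩ (s := 9 / 4) (by norm_num) q
    have e1 := pow_mul_exp_neg_le hm (k - 2) (q.out • z).im_pos.le
    have e2 : (q.out • z).im ^ 2 ≤ z.im ^ (1 / 4 : ℝ) * (R * ‖lowerRow q‖ ^ (-(9 / 4) : ℝ)) := by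
      rw [im_smul_int]
      set J := ‖j (q.out : SL(2, ℝ)) z‖
      -- The exponent 4 splits as 7/4 + 9/4: since 9/4 > 2 the second factor is summable over lower
      -- rows, and the first is at most y^{-7/4}, leaving y^{2 - 7/4} = y^{1/4}.
      have s1 : (z.im / J ^ 2) ^ 2 = z.im ^ (2 : ℝ) * (J ^ (-(7 / 4) : ℝ) * J ^ (-(9 / 4) : ℝ)) := by
        rw [← Real.rpow_add hj, div_pow, ← pow_mul, div_eq_mul_inv]
        congr 1
        · norm_cast
        · rw [show (-(7 / 4) + -(9 / 4) : ℝ) = -((4 : ℕ) : ℝ) by norm_num, Real.rpow_neg hj.le,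
            Real.rpow_natCast]
      have s2 : J ^ (-(7 / 4) : ℝ) ≤ z.im ^ (-(7 / 4) : ℝ) :=
        Real.rpow_le_rpow_of_nonpos hy0 hyj (by norm_num)
      have s3 : z.im ^ (1 / 4 : ℝ) = z.im ^ (2 : ℝ) * z.im ^ (-(7 / 4) : ℝ) := by
        rw [← Real.rpow_add hy0]; norm_num
      rw [s1, s3, mul_assoc]
      gcongr
    have e3 : (q.out • z).im ^ k * Real.exp (-(2 * Real.pi * m * (q.out • z).im)) =
        (q.out • z).im ^ 2 *
          ((q.out • z).im ^ (k - 2) * Real.exp (-(2 * Real.pi * m * (q.out • z).im))) := by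
      rw [← mul_assoc, ← pow_add]
      congr 3
      omega
    rw [e3]
    calc _ ≤ (z.im ^ (1 / 4 : ℝ) * (R * ‖lowerRow q‖ ^ (-(9 / 4) : ℝ))) * (k - 2).factorial := by
          have := (q.out • z).im_pos
          gcongr
      _ = z.im ^ (1 / 4 : ℝ) * (((k - 2).factorial * R) * ‖lowerRow q‖ ^ (-(9 / 4) : ℝ)) := by
          ring
      _ ≤ _ := by
          gcongr
          have : (0 : ℝ) ≤ k.factorial := by positivity
          linarith

/-- The bound that makes the Poincaré series of absolute values square integrable over `fd`. -/
theorem exists_bound_tsum_fd {m k : ℕ} (hm : 1 ≤ m) (hk : 2 ≤ k) :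
    ∃ K : ℝ, ∀ z ∈ fd, ∑' q : CuspCosets, ENNReal.ofReal ((q.out • z).im ^ k *
      Real.exp (-(2 * Real.pi * m * (q.out • z).im))) ≤
        ENNReal.ofReal (K * z.im ^ (1 / 4 : ℝ)) := by
  obtain ⟨K, hK⟩ := exists_bound_term_fd hm hk
  have hs : Summable fun q : CuspCosets => K * ‖lowerRow q‖ ^ (-(9 / 4) : ℝ) :=
    (summable_lowerRow_rpow (s := 9 / 4) (by norm_num)).mul_left K
  refine ⟨∑' q : CuspCosets, K * ‖lowerRow q‖ ^ (-(9 / 4) : ℝ), fun z hz => ?_⟩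
  have h0 : ∀ q : CuspCosets, 0 ≤ (q.out • z).im ^ k *
      Real.exp (-(2 * Real.pi * m * (q.out • z).im)) := fun q => by
    have := (q.out • z).im_pos
    positivity
  have hs' := hs.mul_left (z.im ^ (1 / 4 : ℝ))
  rw [← ENNReal.ofReal_tsum_of_nonneg h0 (Summable.of_nonneg_of_le h0 (hK z hz) hs'),
    mul_comm (∑' _, _), ← tsum_mul_left]
  exact ENNReal.ofReal_le_ofReal (Summable.tsum_le_tsum (hK z hz)
    (Summable.of_nonneg_of_le h0 (hK z hz) hs') hs')

theorem norm_poincareSeries_le {m k : ℕ} (hk : 2 ≤ k) (z : ℍ) :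
    ENNReal.ofReal (z.im ^ k * ‖poincareSeries m k z‖) ≤
      ∑' q : CuspCosets, ENNReal.ofReal ((q.out • z).im ^ k *
        Real.exp (-(2 * Real.pi * m * (q.out • z).im))) := by
  have hs := (summable_norm_poincareCosetTerm m hk z).mul_left (z.im ^ k)
  have h0 : ∀ q : CuspCosets, 0 ≤ z.im ^ k * ‖poincareCosetTerm m k z q‖ := fun q => by
    have := z.im_pos
    positivity
  have h1 : ∀ q : CuspCosets, (q.out • z).im ^ k *
      Real.exp (-(2 * Real.pi * m * (q.out • z).im)) = z.im ^ k * ‖poincareCosetTerm m k z q‖ :=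
    fun q => by rw [poincareCosetTerm_eq, im_pow_mul_norm_poincareTerm]
  simp_rw [h1]
  rw [← ENNReal.ofReal_tsum_of_nonneg h0 hs, tsum_mul_left]
  refine ENNReal.ofReal_le_ofReal (mul_le_mul_of_nonneg_left ?_ (by have := z.im_pos; positivity))
  exact norm_tsum_le_tsum_norm (summable_norm_poincareCosetTerm m hk z)

end BohrSommerfeld

namespace BohrSommerfeld

open Set ModularGroup

/-! ### Reduction of integrals over `SH` to `ℍ` -/

theorem SH.measurable_z : Measurable SH.z := by
  unfold SH.z
  exact measurable_fst.comp measurable_subtype_coe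

theorem SH.measurable_ζ : Measurable SH.ζ := by
  unfold SH.ζ
  exact measurable_snd.comp measurable_subtype_coe

theorem SH.norm_ζ (p : SH) : ‖p.ζ‖ = p.z.im := p.2

theorem SH.measurable_ofAngle : Measurable fun q : ℍ × ℝ => SH.ofAngle q.1 q.2 := by
  unfold SH.ofAngle
  refine Measurable.subtype_mk (measurable_fst.prodMk ?_)
  have h : Measurable fun z : ℍ => z.im := continuous_im.measurable
  fun_prop

/-- The fibre measure dφ/2π has total mass 1. -/
theorem measurePreserving_z : MeasurePreserving SH.z dV volume := by
  refine ⟨SH.measurable_z, ?_⟩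
  rw [dV, Measure.map_map SH.measurable_z SH.measurable_ofAngle]
  have h : SH.z ∘ (fun q : ℍ × ℝ => SH.ofAngle q.1 q.2) = Prod.fst := rfl
  have hpi : ENNReal.ofReal (2 * Real.pi) ≠ 0 := by
    simp [Real.pi_pos]
  rw [h, Measure.map_fst_prod, Measure.smul_apply, Measure.restrict_apply_univ, Real.volume_Ioc,
    sub_zero, smul_eq_mul, ENNReal.inv_mul_cancel hpi ENNReal.ofReal_ne_top, one_smul]

theorem measurePreserving_z_fd :
    MeasurePreserving SH.z (dV.restrict {p | p.z ∈ fd}) (volume.restrict fd) :=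
  measurePreserving_z.restrict_preimage measurableSet_fd

theorem memLp_iff_of_eq {k : ℕ} {f : ℍ → ℂ} (hf : Measurable f) {F : SH → ℂ}
    (hF : ∀ p, F p = p.ζ ^ k * f p.z) :
    MemLp F 2 (dV.restrict {p | p.z ∈ fd}) ↔
      MemLp (fun z : ℍ => z.im ^ k * ‖f z‖) 2 (volume.restrict fd) := by
  have hFm : Measurable F := by
    rw [funext hF]
    exact (SH.measurable_ζ.pow_const k).mul (hf.comp SH.measurable_z)
  have him : Measurable fun z : ℍ => z.im := continuous_im.measurable
  rw [← memLp_norm_iff hFm.aestronglyMeasurable, ← measurePreserving_z_fd.map_eq,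
    memLp_map_measure_iff (by fun_prop) SH.measurable_z.aemeasurable]
  refine iff_of_eq (congrArg (fun h => MemLp h 2 _) (funext fun p => ?_))
  simp [hF, SH.norm_ζ]

theorem ip_eq {k : ℕ} {f g : ℍ → ℂ} (hf : Measurable f) (hg : Measurable g) {F G : SH → ℂ}
    (hF : ∀ p, F p = p.ζ ^ k * f p.z) (hG : ∀ p, G p = p.ζ ^ k * g p.z) :
    ip fd F G = ∫ z in fd, (z.im : ℂ) ^ (2 * k) * (f z * conj (g z)) := by
  have him : Measurable fun z : ℍ => z.im := continuous_im.measurable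
  rw [ip, ← measurePreserving_z_fd.map_eq, integral_map SH.measurable_z.aemeasurable]
  · refine integral_congr_ae (.of_forall fun p => ?_)
    have h : p.ζ * conj p.ζ = (p.z.im : ℂ) ^ 2 := by
      rw [Complex.mul_conj, Complex.normSq_eq_norm_sq, SH.norm_ζ]; norm_cast
    simp only [hF, hG, map_mul, map_pow]
    rw [pow_mul, ← h]
    ring
  · have hc : Measurable fun z => conj (g z) := Complex.continuous_conj.measurable.comp hg
    exact ((Complex.measurable_ofReal.comp him).pow_const _ |>.mul
      (hf.mul hc)).aestronglyMeasurable

theorem measurable_of_mdifferentiable {f : ℍ → ℂ} (hf : MDifferentiable 𝓘(ℂ) 𝓘(ℂ) f) :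
    Measurable f := hf.continuous.measurable

/-! ### Square integrability of the Poincaré series -/

/-- On `fd` one has |x| ≤ 1/2 and y ≥ 1/2, and the squared function against dy/y² is y^{-3/2},
integrable at infinity. -/
theorem memLp_im_rpow : MemLp (fun z : ℍ => z.im ^ (1 / 4 : ℝ)) 2 (volume.restrict fd) := by
  have him : Measurable fun z : ℍ => z.im := continuous_im.measurable
  rw [memLp_two_iff_integrable_sq (him.pow_const _).aestronglyMeasurable]
  have hsub : fd ⊆ {z : ℍ | z.re ∈ Icc (-(1 / 2)) (1 / 2 : ℝ)} := fun z hz => abs_le.mp hz.2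
  have hh : Measurable fun y : ℝ => (Ici (1 / 2 : ℝ)).indicator
      (fun y => ((y ^ (1 / 4 : ℝ)) ^ 2)) y :=
    Measurable.indicator (by fun_prop) measurableSet_Ici
  have key : Integrable (fun z : ℍ => (Ici (1 / 2 : ℝ)).indicator
      (fun y => ((y ^ (1 / 4 : ℝ)) ^ 2)) z.im)
      ((volume : Measure ℍ).restrict {z | z.re ∈ Icc (-(1 / 2)) (1 / 2 : ℝ)}) := by
    rw [← map_ofCoords_restrict measurableSet_Icc]
    refine (integrable_map_measure (Measurable.aestronglyMeasurable (hh.comp him))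
        measurable_ofCoords.aemeasurable).mpr ?_
    have h1 : Integrable (fun y : ℝ => (Ici (1 / 2 : ℝ)).indicator
        (fun y => ((y ^ (1 / 4 : ℝ)) ^ 2)) y) imMeasure := by
      rw [imMeasure, integrable_withDensity_iff (by fun_prop) (.of_forall fun _ => by simp)]
      have h2 : IntegrableOn (fun y : ℝ => y ^ (-(3 / 2) : ℝ)) (Ioi (1 / 4)) :=
        integrableOn_Ioi_rpow_of_lt (by norm_num) (by norm_num)
      have h3 : IntegrableOn (fun y : ℝ => y ^ (-(3 / 2) : ℝ)) (Ici (1 / 2)) :=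
        h2.mono_set fun y (hy : 1 / 2 ≤ y) =>
          (show (1 / 4 : ℝ) < y by linarith)
      refine (h3.integrable_indicator measurableSet_Ici).integrableOn.congr ?_
      filter_upwards [ae_restrict_mem measurableSet_Ioi] with y hy
      have hy : 0 < y := hy
      by_cases h : y ∈ Ici (1 / 2 : ℝ)
      · rw [indicator_of_mem h, indicator_of_mem h, ENNReal.toReal_ofReal (by positivity),
          ← Real.rpow_natCast, ← Real.rpow_mul hy.le, ← Real.rpow_natCast, ← Real.rpow_neg hy.le,
          ← Real.rpow_add hy]
        norm_num
      · rw [indicator_of_notMem h, indicator_of_notMem h, zero_mul]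
    refine (h1.comp_snd (volume.restrict (Icc (-(1 / 2)) (1 / 2 : ℝ)))).congr ?_
    rw [imMeasure, prod_withDensity_right (by fun_prop)]
    refine (withDensity_absolutelyContinuous _ _).ae_le ?_
    rw [Measure.prod_restrict]
    filter_upwards [ae_restrict_mem (measurableSet_Icc.prod measurableSet_Ioi)] with p hp
    have hp2 : 0 < p.2 := hp.2
    simp only [Function.comp_apply, ofCoords_im hp2]
  refine (key.mono_measure (Measure.restrict_mono hsub le_rfl)).congr ?_
  filter_upwards [ae_restrict_mem measurableSet_fd] with z hz
  rw [indicator_of_mem (show z.im ∈ Ici (1 / 2 : ℝ) from half_le_im_of_mem_fd hz)]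

theorem memLp_poincareSeries {m k : ℕ} (hm : 1 ≤ m) (hk : 2 ≤ k) :
    MemLp (fun z : ℍ => z.im ^ k * ‖poincareSeries m k z‖) 2 (volume.restrict fd) := by
  obtain ⟨K, hK⟩ := exists_bound_tsum_fd hm hk
  have him : Measurable fun z : ℍ => z.im := continuous_im.measurable
  have hP := measurable_of_mdifferentiable (mdifferentiable_poincareSeries m hk)
  refine (memLp_im_rpow.const_mul K).mono (by fun_prop) ?_
  filter_upwards [ae_restrict_mem measurableSet_fd] with z hz
  have h1 := (norm_poincareSeries_le hk z).trans (hK z hz)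
  have hy := z.im_pos
  have h2 : (0 : ℝ) ≤ z.im ^ k * ‖poincareSeries m k z‖ := by positivity
  rw [Real.norm_of_nonneg h2]
  -- The sign of K is not recorded; if the bound is nonpositive, `ENNReal.ofReal` truncates it to 0.
  rcases le_or_gt (K * z.im ^ (1 / 4 : ℝ)) 0 with h3 | h3
  · rw [ENNReal.ofReal_of_nonpos h3, nonpos_iff_eq_zero, ENNReal.ofReal_eq_zero] at h1
    exact h1.trans (norm_nonneg _)
  · exact ((ENNReal.ofReal_le_ofReal_iff h3.le).mp h1).trans (le_abs_self _)

/-! ### The Poincaré series is in the Hardy space -/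

theorem SH.z_smul (g : SL(2, ℝ)) (p : SH) : (g • p).z = g • p.z := rfl

theorem SH.ζ_smul (g : SL(2, ℝ)) (p : SH) : (g • p).ζ = (j g p.z)⁻¹ ^ 2 * p.ζ := rfl

theorem poincareSeries_mem_hardy {m k : ℕ} (hm : 1 ≤ m) (hk : 2 ≤ k) :
    (fun p : SH => p.ζ ^ k * poincareSeries m k p.z) ∈ hardy modularGroup fd k := by
  have hP := mdifferentiable_poincareSeries m hk
  refine ⟨⟨_, hP, fun p => rfl⟩, ?_, ?_⟩
  · rintro _ ⟨h, rfl⟩ p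
    have h1 := poincareSeries_smul m k p.z h
    have h2 := j_ne_zero (h : SL(2, ℝ)) p.z
    have h3 : h • p.z = (h : SL(2, ℝ)) • p.z := rfl
    simp only [SH.z_smul, SH.ζ_smul]
    rw [← h3, h1, mul_pow, ← pow_mul, inv_pow]
    field_simp
  · rw [memLp_iff_of_eq (measurable_of_mdifferentiable hP) fun p => rfl]
    exact memLp_poincareSeries hm hk

end BohrSommerfeld

namespace BohrSommerfeld

/-! ### Horizontal lifts of horizontal lines -/

theorem hasDerivAt_entry {G : ℝ → SL(2, ℝ)} (hG : ∀ a b, ContDiff ℝ ∞ (fun t => G t a b))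
    (a b : Fin 2) (t : ℝ) :
    HasDerivAt (fun s => G s a b) (deriv (fun s => G s a b) t) t :=
  (((hG a b).differentiable (by simp)) t).hasDerivAt

/-- The derivative of a curve `G` in `SL(2, ℝ)` with `G⁻¹ G'` symmetric and traceless. -/
theorem deriv_of_horizontal {G : ℝ → SL(2, ℝ)} {t : ℝ}
    (h : let A : Matrix (Fin 2) (Fin 2) ℝ :=
        ((G t)⁻¹ : SL(2, ℝ)) * Matrix.of (fun a b => deriv (fun s => G s a b) t)
      A.trace = 0 ∧ A.IsSymm) :
    ∃ p q : ℝ, ∀ a, deriv (fun s => G s a 0) t = G t a 0 * p + G t a 1 * q ∧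
      deriv (fun s => G s a 1) t = G t a 0 * q - G t a 1 * p := by
  set D : Matrix (Fin 2) (Fin 2) ℝ := Matrix.of (fun a b => deriv (fun s => G s a b) t) with hD
  set A : Matrix (Fin 2) (Fin 2) ℝ := ((G t)⁻¹ : SL(2, ℝ)) * D with hA
  obtain ⟨h1, h2⟩ := h
  have h3 : D = (G t : Matrix (Fin 2) (Fin 2) ℝ) * A := by
    rw [hA, ← Matrix.mul_assoc, ← Matrix.SpecialLinearGroup.coe_mul, mul_inv_cancel,
      Matrix.SpecialLinearGroup.coe_one, Matrix.one_mul]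
  rw [Matrix.trace_fin_two] at h1
  have h4 : A 1 0 = A 0 1 := h2.apply 0 1
  refine ⟨A 0 0, A 1 0, fun a => ⟨?_, ?_⟩⟩
  · have := congrFun (congrFun h3 a) 0
    rw [Matrix.mul_apply, Fin.sum_univ_two] at this
    exact this
  · have := congrFun (congrFun h3 a) 1
    rw [Matrix.mul_apply, Fin.sum_univ_two] at this
    refine this.trans ?_
    rw [← h4, eq_neg_of_add_eq_zero_right h1]
    ring

/-- A horizontal lift of the line `t ↦ iy + t` rotates with angular velocity `-1 / y`. -/
theorem ζ_of_isHorizontalLift {c : ℝ → SH} {γ : ℝ → ℍ} (hc : IsHorizontalLift c γ) {y : ℝ}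
    (hy : 0 < y) (hγ : ∀ t : ℝ, (γ t : ℂ) = y * Complex.I + t) (t : ℝ) :
    (c t).ζ = (c 0).ζ * Complex.exp (-(t / y) * Complex.I) := by
  obtain ⟨⟨G, hG, hA, hcG⟩, hz⟩ := hc
  -- With G·i = u/v, v is the automorphy factor at i, so ζ = v⁻² and u = γv.
  set v : ℝ → ℂ := fun t => (G t 1 0 : ℂ) * Complex.I + G t 1 1 with hv
  set u : ℝ → ℂ := fun t => (G t 0 0 : ℂ) * Complex.I + G t 0 1 with hu
  have hj : ∀ t, v t = j (G t) UpperHalfPlane.I := fun t => rfl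
  have hv0 : ∀ t, v t ≠ 0 := fun t => by rw [hj]; exact j_ne_zero _ _
  have hζ : ∀ t, (c t).ζ = (v t)⁻¹ ^ 2 := fun t => by
    rw [hcG, hj]
    exact mul_one _
  have huv : ∀ t : ℝ, u t = (y * Complex.I + t) * v t := fun t => by
    have h1 : (c t).z = G t • UpperHalfPlane.I := by rw [hcG]; rfl
    rw [← hγ, ← hz, h1, coe_specialLinearGroup_apply]
    have := hv0 t
    simp only [hv, hu] at this ⊢
    simp only [coe_I, Algebra.algebraMap_self, RingHom.id_apply]
    exact (div_mul_cancel₀ _ this).symm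
  -- For G⁻¹G' = (p q; q -p) the columns combine to u' = (iq - p)ū and v' = (iq - p)v̄. Since ū = (t
  -- - iy)v̄, u' = (t - iy)v'. Comparing with the derivative v + (t + iy)v' of (t + iy)v gives v' =
  -- iv/(2y).
  have hdv : ∀ t, HasDerivAt v (Complex.I / (2 * y) * v t) t := fun t => by
    obtain ⟨p, q, hpq⟩ := deriv_of_horizontal (hA t)
    have e : ∀ a b, HasDerivAt (fun s => (G s a b : ℂ))
        ((deriv (fun s => G s a b) t : ℝ) : ℂ) t :=
      fun a b => (hasDerivAt_entry hG a b t).ofReal_comp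
    have hdv' := ((e 1 0).mul_const Complex.I).add (e 1 1)
    have hdu' := ((e 0 0).mul_const Complex.I).add (e 0 1)
    have hdu2 : HasDerivAt u _ t := hdu'
    have hid : HasDerivAt (fun t : ℝ => (y * Complex.I + t : ℂ)) 1 t :=
      (Complex.ofRealCLM.hasDerivAt (x := t)).const_add _
    rw [funext huv] at hdu2
    have heq := hdu2.unique (hid.mul hdv')
    rw [(hpq 0).1, (hpq 0).2, (hpq 1).1, (hpq 1).2] at heq
    have hu1 := huv t
    simp only [hu, hv] at hu1
    refine hdv'.congr_deriv ?_
    rw [(hpq 1).1, (hpq 1).2]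
    have hyc : (y : ℂ) ≠ 0 := by exact_mod_cast hy.ne'
    have hu2 := congrArg conj hu1
    simp only [map_add, map_mul, Complex.conj_ofReal, Complex.conj_I] at hu2
    rw [div_mul_eq_mul_div, eq_div_iff (mul_ne_zero two_ne_zero hyc)]
    simp only [hv]
    push_cast at heq ⊢
    have hI : Complex.I ^ 2 = -1 := Complex.I_sq
    have hvt : v t = (G t 1 0 : ℂ) * Complex.I + G t 1 1 := rfl
    rw [hvt] at heq
    generalize (G t 0 0 : ℂ) = a at *
    generalize (G t 0 1 : ℂ) = b at *
    generalize (G t 1 0 : ℂ) = c at *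
    generalize (G t 1 1 : ℂ) = d at *
    have e1 : (c * p + d * q) * Complex.I + (c * q - d * p) =
        (Complex.I * q - p) * (c * -Complex.I + d) := by
      linear_combination c * q * hI
    have e2 : (a * p + b * q) * Complex.I + (a * q - b * p) =
        (Complex.I * q - p) * (a * -Complex.I + b) := by
      linear_combination a * q * hI
    linear_combination Complex.I * heq - Complex.I * e2 -
      Complex.I * (Complex.I * q - p) * hu2 +
      (2 * y + y * Complex.I ^ 2 + t * Complex.I) * e1 +
      2 * y * ((Complex.I * q - p) * (c * -Complex.I + d)) * hI
  have hconst : ∀ s : ℝ, HasDerivAt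
      (fun s : ℝ => v s * Complex.exp (-(Complex.I / (2 * y)) * s)) 0 s := fun s => by
    have h1 : HasDerivAt (fun s : ℝ => -(Complex.I / (2 * y)) * (s : ℂ))
        (-(Complex.I / (2 * y)) * 1) s :=
      (Complex.ofRealCLM.hasDerivAt (x := s)).const_mul _
    refine ((hdv s).mul h1.cexp).congr_deriv ?_
    ring
  have h1 := is_const_of_deriv_eq_zero (fun s => (hconst s).differentiableAt)
    (fun s => (hconst s).deriv) t 0
  simp only [Complex.ofReal_zero, mul_zero, Complex.exp_zero, mul_one] at h1
  rw [hζ, hζ, ← h1, mul_inv, mul_pow, mul_assoc, ← Complex.exp_neg, ← Complex.exp_nat_mul,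
    ← Complex.exp_add]
  have hyc : (y : ℂ) ≠ 0 := by exact_mod_cast hy.ne'
  rw [eq_comm, mul_eq_left₀ (pow_ne_zero _ (inv_ne_zero (hv0 t))), ← Complex.exp_zero]
  congr 1
  push_cast
  field_simp
  ring

/-- The explicit curve in `SL(2, ℝ)` over the line `t ↦ is² + t`. -/
noncomputable def lineCurve (s : ℝ) (hs : s ≠ 0) (t : ℝ) : SL(2, ℝ) :=
  ⟨!![s * Real.cos (-(2 * s ^ 2)⁻¹ * t) - t / s * Real.sin (-(2 * s ^ 2)⁻¹ * t),
      s * Real.sin (-(2 * s ^ 2)⁻¹ * t) + t / s * Real.cos (-(2 * s ^ 2)⁻¹ * t);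
      -Real.sin (-(2 * s ^ 2)⁻¹ * t) / s, Real.cos (-(2 * s ^ 2)⁻¹ * t) / s], by
    rw [Matrix.det_fin_two_of]
    have := Real.sin_sq_add_cos_sq (-(2 * s ^ 2)⁻¹ * t)
    generalize Real.sin (-(2 * s ^ 2)⁻¹ * t) = S at *
    generalize Real.cos (-(2 * s ^ 2)⁻¹ * t) = C at *
    field_simp
    linear_combination s ^ 2 * this⟩

/-- `lineCurve` is the triangular matrix (s t/s; 0 1/s) times a rotation. The triangular part
contributes (0 s⁻²; 0 0) to G⁻¹G', up to conjugation by the rotation, and the angular speed -1/(2s²)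
cancels its skew part. -/
theorem isHorizontal_lineCurve (s : ℝ) (hs : s ≠ 0) :
    IsHorizontal fun t => lineCurve s hs t • basePoint := by
  refine ⟨lineCurve s hs, ?_, ?_, fun t => rfl⟩
  · intro a b
    fin_cases a <;> fin_cases b <;> simp [lineCurve] <;> fun_prop
  · intro t
    set κ : ℝ := -(2 * s ^ 2)⁻¹ with hκ
    have hid : HasDerivAt (fun t : ℝ => t / s) (1 / s) t := (hasDerivAt_id t).div_const s
    have hl : HasDerivAt (fun t : ℝ => κ * t) (κ * 1) t := (hasDerivAt_id t).const_mul κ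
    have d00 : deriv (fun t => lineCurve s hs t 0 0) t = _ :=
      ((hl.cos.const_mul s).sub (hid.mul hl.sin)).deriv
    have d01 : deriv (fun t => lineCurve s hs t 0 1) t = _ :=
      ((hl.sin.const_mul s).add (hid.mul hl.cos)).deriv
    have d10 : deriv (fun t => lineCurve s hs t 1 0) t = _ := (hl.sin.neg.div_const s).deriv
    have d11 : deriv (fun t => lineCurve s hs t 1 1) t = _ := (hl.cos.div_const s).deriv
    have hκs : κ * s ^ 2 = -(1 / 2) := by rw [hκ]; field_simp
    intro A
    have hA : ∀ a b, A a b = ((lineCurve s hs t)⁻¹ : SL(2, ℝ)) a 0 *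
        deriv (fun t => lineCurve s hs t 0 b) t +
        ((lineCurve s hs t)⁻¹ : SL(2, ℝ)) a 1 * deriv (fun t => lineCurve s hs t 1 b) t := by
      intro a b
      simp only [A, Matrix.mul_apply, Fin.sum_univ_two, Matrix.of_apply]
    have e : ∀ a b, (lineCurve s hs t) a b = (!![s * Real.cos (κ * t) - t / s * Real.sin (κ * t),
      s * Real.sin (κ * t) + t / s * Real.cos (κ * t);
      -Real.sin (κ * t) / s, Real.cos (κ * t) / s] : Matrix (Fin 2) (Fin 2) ℝ) a b :=
      fun a b => rfl
    have i00 : ((lineCurve s hs t)⁻¹ : SL(2, ℝ)) 0 0 = lineCurve s hs t 1 1 := by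
      simp [Matrix.SpecialLinearGroup.coe_inv, Matrix.adjugate_fin_two]
    have i01 : ((lineCurve s hs t)⁻¹ : SL(2, ℝ)) 0 1 = -lineCurve s hs t 0 1 := by
      simp [Matrix.SpecialLinearGroup.coe_inv, Matrix.adjugate_fin_two]
    have i10 : ((lineCurve s hs t)⁻¹ : SL(2, ℝ)) 1 0 = -lineCurve s hs t 1 0 := by
      simp [Matrix.SpecialLinearGroup.coe_inv, Matrix.adjugate_fin_two]
    have i11 : ((lineCurve s hs t)⁻¹ : SL(2, ℝ)) 1 1 = lineCurve s hs t 0 0 := by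
      simp [Matrix.SpecialLinearGroup.coe_inv, Matrix.adjugate_fin_two]
    constructor
    · rw [Matrix.trace_fin_two, hA, hA, d00, d01, d10, d11, i00, i01, i10, i11, e, e, e, e]
      simp only [Matrix.of_apply, Matrix.cons_val_zero, Matrix.cons_val_one, Matrix.cons_val',
        Matrix.cons_val_fin_one]
      generalize Real.sin (κ * t) = S at *
      generalize Real.cos (κ * t) = C at *
      ring
    · refine Matrix.IsSymm.ext fun a b => ?_
      have h01 : A 1 0 = A 0 1 := by
        rw [hA, hA, d00, d01, d10, d11, i00, i01, i10, i11, e, e, e, e]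
        simp only [Matrix.of_apply, Matrix.cons_val_zero, Matrix.cons_val_one, Matrix.cons_val',
          Matrix.cons_val_fin_one]
        generalize Real.sin (κ * t) = S at *
        generalize Real.cos (κ * t) = C at *
        clear_value κ
        field_simp
        linear_combination (-2 * (S ^ 2 + C ^ 2)) * hκs
      fin_cases a <;> fin_cases b
      exacts [rfl, h01, h01.symm, rfl]

theorem exists_isHorizontalLift {γ : ℝ → ℍ} {y : ℝ} (hy : 0 < y)
    (hγ : ∀ t : ℝ, (γ t : ℂ) = y * Complex.I + t) : ∃ c, IsHorizontalLift c γ := by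
  have hs : √y ≠ 0 := (Real.sqrt_pos.mpr hy).ne'
  refine ⟨_, isHorizontal_lineCurve (√y) hs, fun t => UpperHalfPlane.ext ?_⟩
  have h1 : ((lineCurve (√y) hs t • basePoint).z : ℂ) =
    ((lineCurve (√y) hs t • UpperHalfPlane.I : ℍ) : ℂ) := rfl
  have h2 := j_ne_zero (lineCurve (√y) hs t) UpperHalfPlane.I
  rw [hγ, h1, coe_specialLinearGroup_apply]
  rw [j] at h2
  simp only [coe_I, Algebra.algebraMap_self, RingHom.id_apply] at h2 ⊢
  rw [div_eq_iff h2]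
  have hsq : ((√y : ℝ) : ℂ) ^ 2 = y := by exact_mod_cast Real.sq_sqrt hy.le
  have hsc : ((√y : ℝ) : ℂ) ≠ 0 := by exact_mod_cast hs
  simp only [lineCurve, Matrix.of_apply, Matrix.cons_val_zero, Matrix.cons_val_one,
    Matrix.cons_val', Matrix.cons_val_fin_one]
  generalize Real.sin _ = S at *
  generalize Real.cos _ = C at *
  push_cast
  rw [← hsq]
  field_simp
  linear_combination (√y : ℂ) ^ 2 * S * Complex.I_sq

end BohrSommerfeld

namespace BohrSommerfeld

open Set ModularGroup

/-! ### Modular transformation of the functions in the Hardy space -/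

theorem eq_smul_of_invariant {k : ℕ} {f : ℍ → ℂ} {F : SH → ℂ} (hF : ∀ p, F p = p.ζ ^ k * f p.z)
    (hinv : ∀ g ∈ modularGroup, ∀ p, F (g • p) = F p) (g : SL(2, ℤ)) (z : ℍ) :
    f (g • z) = j (g : SL(2, ℝ)) z ^ (2 * k) * f z := by
  -- Any point over z would do: ζ ≠ 0 there, so ζᵏ cancels.
  have h := hinv _ ⟨g, rfl⟩ (SH.ofAngle z 0)
  have hz : (SH.ofAngle z 0).z = z := rfl
  have hζ : (SH.ofAngle z 0).ζ ≠ 0 := by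
    rw [← norm_ne_zero_iff, SH.norm_ζ]; exact (SH.ofAngle z 0).z.im_pos.ne'
  have hj := j_ne_zero (g : SL(2, ℝ)) z
  rw [hF, hF, SH.z_smul, SH.ζ_smul, hz, mul_pow, mul_right_comm] at h
  have h2 : (j (g : SL(2, ℝ)) z)⁻¹ ^ (2 * k) * f (g • z) = f z := by
    rw [pow_mul]
    refine mul_right_cancel₀ (pow_ne_zero k hζ) ?_
    rw [mul_comm (f z)]
    exact h
  rw [← h2, ← mul_assoc, ← mul_pow, mul_inv_cancel₀ hj, one_pow, one_mul]

/-- `f` transforms under `SL(2, ℤ)` like a modular form of weight `2k`. -/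
def IsWeight (k : ℕ) (f : ℍ → ℂ) : Prop :=
  ∀ (g : SL(2, ℤ)) z, f (g • z) = j (g : SL(2, ℝ)) z ^ (2 * k) * f z

theorem IsWeight.T_zpow {k : ℕ} {f : ℍ → ℂ} (hf : IsWeight k f) (n : ℤ) (z : ℍ) :
    f (T ^ n • z) = f z := by
  rw [hf, j_int, coe_T_zpow]
  simp

theorem IsWeight.im_pow_mul_norm {k : ℕ} {f : ℍ → ℂ} (hf : IsWeight k f) (g : SL(2, ℤ)) (z : ℍ) :
    (g • z).im ^ k * ‖f (g • z)‖ = z.im ^ k * ‖f z‖ := by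
  have := norm_j_int_pos g z
  rw [hf, im_smul_int, norm_mul, norm_pow, div_pow, ← pow_mul]
  field_simp

/-! ### The unfolded integrand -/

/-- The function on the strip whose sum over `Γ_∞ \ SL(2, ℤ)` is `y²ᵏ f \bar P_{m,k}`. -/
noncomputable def unfolded (m k : ℕ) (f : ℍ → ℂ) (z : ℍ) : ℂ :=
  (z.im : ℂ) ^ (2 * k) * (f z * conj (Complex.exp (2 * Real.pi * Complex.I * m * z)))

theorem measurable_unfolded (m k : ℕ) {f : ℍ → ℂ} (hf : Measurable f) :
    Measurable (unfolded m k f) := by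
  have him : Measurable fun z : ℍ => z.im := continuous_im.measurable
  have h1 : Measurable fun z : ℍ => conj (Complex.exp (2 * Real.pi * Complex.I * m * (z : ℂ))) :=
    Complex.continuous_conj.measurable.comp (by fun_prop)
  exact ((Complex.measurable_ofReal.comp him).pow_const _).mul (hf.mul h1)

/-- The factor j²ᵏ from f against |j|⁻⁴ᵏ from y²ᵏ leaves the conjugate of j⁻²ᵏ, the automorphy
factor of the conjugated Poincaré term. -/
theorem unfolded_smul {m k : ℕ} {f : ℍ → ℂ} (hf : IsWeight k f) (g : SL(2, ℤ)) (z : ℍ) :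
    unfolded m k f (g • z) = (z.im : ℂ) ^ (2 * k) * (f z * conj (poincareTerm m k z g)) := by
  have hj := j_ne_zero (g : SL(2, ℝ)) z
  have hj' : conj (j (g : SL(2, ℝ)) z) ≠ 0 := by simpa using hj
  have h : ((‖j (g : SL(2, ℝ)) z‖ : ℝ) : ℂ) ^ 2 =
      j (g : SL(2, ℝ)) z * conj (j (g : SL(2, ℝ)) z) := by
    rw [Complex.mul_conj, Complex.normSq_eq_norm_sq]; norm_cast
  rw [unfolded, poincareTerm, hf, im_smul_int, map_div₀, map_pow]
  push_cast
  rw [h, div_pow, mul_pow]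
  field_simp

theorem norm_unfolded_smul {m k : ℕ} {f : ℍ → ℂ} (hf : IsWeight k f) (g : SL(2, ℤ)) (z : ℍ) :
    ‖unfolded m k f (g • z)‖ = z.im ^ k * ‖f z‖ *
      ((g • z).im ^ k * Real.exp (-(2 * Real.pi * m * (g • z).im))) := by
  rw [← hf.im_pow_mul_norm g, unfolded, norm_mul, norm_mul, RCLike.norm_conj,
    norm_cexp_two_pi_I_mul, norm_pow, Complex.norm_of_nonneg (g • z).im_pos.le, coe_im]
  ring

theorem unfolded_T_zpow (m : ℕ) {k : ℕ} {f : ℍ → ℂ} (hf : IsWeight k f) (n : ℤ) (z : ℍ) :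
    unfolded m k f (T ^ n • z) = unfolded m k f z := by
  rw [unfolded, unfolded, hf.T_zpow, im_T_zpow_smul, coe_T_zpow_smul_eq, mul_add, Complex.exp_add]
  have h1 : Complex.exp (2 * Real.pi * Complex.I * m * (n : ℂ)) = 1 :=
    Complex.exp_eq_one_iff.mpr ⟨m * n, by push_cast; ring⟩
  rw [h1, mul_one]

/-- Folding back to `fd` gives yᵏ|f| times the sum bounded by K y^{1/4}, a product of two square
integrable bounds. -/
theorem lintegral_unfolded_ne_top {m k : ℕ} (hm : 1 ≤ m) (hk : 2 ≤ k) {f : ℍ → ℂ}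
    (hfm : Measurable f) (hf : IsWeight k f)
    (hL2 : MemLp (fun z : ℍ => z.im ^ k * ‖f z‖) 2 (volume.restrict fd)) :
    ∫⁻ z in strip, ‖unfolded m k f z‖ₑ ≠ ⊤ := by
  obtain ⟨K, hK⟩ := exists_bound_tsum_fd hm hk
  rw [← lintegral_unfold (measurable_unfolded m k hfm).enorm
    (fun n z => by rw [unfolded_T_zpow m hf])]
  have hint : Integrable (fun z : ℍ => (z.im ^ k * ‖f z‖) * (K * z.im ^ (1 / 4 : ℝ)))
      (volume.restrict fd) := hL2.integrable_mul (memLp_im_rpow.const_mul K)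
  refine ne_top_of_le_ne_top hint.lintegral_lt_top.ne (setLIntegral_mono_ae' measurableSet_fd
    (.of_forall fun z hz => ?_))
  have h0 : 0 ≤ z.im ^ k * ‖f z‖ := by have := z.im_pos; positivity
  simp_rw [← ofReal_norm, norm_unfolded_smul hf, ENNReal.ofReal_mul h0]
  rw [ENNReal.tsum_mul_left]
  gcongr
  exact hK z hz

theorem tsum_unfolded {m k : ℕ} {f : ℍ → ℂ} (hf : IsWeight k f) (z : ℍ) :
    ∑' q : CuspCosets, unfolded m k f (q.out • z) =
      (z.im : ℂ) ^ (2 * k) * (f z * conj (poincareSeries m k z)) := by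
  simp_rw [unfolded_smul hf]
  rw [tsum_mul_left, tsum_mul_left, poincareSeries, Complex.conj_tsum]
  simp_rw [poincareCosetTerm_eq]

/-! ### Fourier coefficients -/

/-- The function `f(w) e^{-2πi m w}` whose means over horizontal segments of length one are the
Fourier coefficient of `f` of index `m`. -/
noncomputable def twisted (m : ℕ) (f : ℍ → ℂ) (w : ℂ) : ℂ :=
  f (ofComplex w) * Complex.exp (-(2 * Real.pi * Complex.I * m * w))

/-- The `m`-th Fourier coefficient of `f`, as an integral at height `y`. -/
noncomputable def fourierMean (m : ℕ) (f : ℍ → ℂ) (y : ℝ) : ℂ :=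
  ∫ x : ℝ in (0 : ℝ)..1, twisted m f (x + y * Complex.I)

theorem differentiableOn_twisted (m : ℕ) {f : ℍ → ℂ} (hf : MDifferentiable 𝓘(ℂ) 𝓘(ℂ) f) :
    DifferentiableOn ℂ (twisted m f) {w | 0 < w.im} :=
  (UpperHalfPlane.mdifferentiable_iff.mp hf).mul (by fun_prop)

theorem twisted_one_add (m : ℕ) {k : ℕ} {f : ℍ → ℂ} (hf : IsWeight k f) {y : ℝ} (hy : 0 < y) :
    twisted m f (1 + y * Complex.I) = twisted m f (y * Complex.I) := by
  have h1 : ofComplex (1 + y * Complex.I) = T ^ (1 : ℤ) • ofComplex (y * Complex.I) := by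
    refine UpperHalfPlane.ext ?_
    rw [coe_T_zpow_smul_eq, ofComplex_apply_of_im_pos (by simpa using hy),
      ofComplex_apply_of_im_pos (by simpa using hy)]
    push_cast
    ring
  rw [twisted, twisted, h1, hf.T_zpow, mul_add, neg_add, Complex.exp_add]
  have h2 : Complex.exp (-(2 * Real.pi * Complex.I * m * 1)) = 1 :=
    Complex.exp_eq_one_iff.mpr ⟨-m, by push_cast; ring⟩
  rw [h2, one_mul]

/-- Cauchy's theorem on the rectangle between the two heights: the vertical sides cancel by
periodicity. -/
theorem fourierMean_eq (m : ℕ) {k : ℕ} {f : ℍ → ℂ} (hf : IsWeight k f)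
    (hd : MDifferentiable 𝓘(ℂ) 𝓘(ℂ) f) {y y' : ℝ} (hy : 0 < y) (hy' : 0 < y') :
    fourierMean m f y = fourierMean m f y' := by
  have h := Complex.integral_boundary_rect_eq_zero_of_differentiableOn (twisted m f)
    (y * Complex.I) (1 + y' * Complex.I) ((differentiableOn_twisted m hd).mono ?_)
  · simp only [Complex.mul_re, Complex.mul_im, Complex.ofReal_re, Complex.ofReal_im,
      Complex.I_re, Complex.I_im, Complex.add_re, Complex.add_im, Complex.one_re, Complex.one_im,
      mul_zero, mul_one, sub_zero, add_zero, zero_add, Complex.ofReal_zero,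
      Complex.ofReal_one] at h
    have h2 : ∫ s : ℝ in y..y', twisted m f (1 + s * Complex.I) =
        ∫ s : ℝ in y..y', twisted m f (s * Complex.I) := by
      refine intervalIntegral.integral_congr fun s hs => twisted_one_add m hf ?_
      exact (lt_min hy hy').trans_le hs.1
    rw [h2, add_sub_cancel_right, sub_eq_zero] at h
    exact h
  · rintro w hw
    have h2 := (Complex.mem_reProdIm.mp hw).2
    simp only [Complex.mul_im, Complex.ofReal_re, Complex.ofReal_im, Complex.I_re, Complex.I_im,
      Complex.add_im, Complex.one_im, mul_zero, mul_one, add_zero, zero_add] at h2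
    exact (lt_min hy hy').trans_le h2.1

/-- The conjugate of e^{2πimz} is e^{-4πmy}e^{-2πimz}: the nonholomorphic factor depends on y alone.
-/
theorem unfolded_ofCoords (m k : ℕ) (f : ℍ → ℂ) {x y : ℝ} (hy : 0 < y) :
    unfolded m k f (ofCoords (x, y)) = ((y ^ (2 * k) * Real.exp (-(4 * Real.pi * m * y)) : ℝ) : ℂ) *
      twisted m f (x + y * Complex.I) := by
  have h1 : ofCoords (x, y) = ofComplex (x + y * Complex.I) := rfl
  rw [unfolded, twisted, ofCoords_im (p := (x, y)) hy, coe_ofCoords (p := (x, y)) hy, h1,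
    ← Complex.exp_conj]
  push_cast
  have h2 : conj (2 * Real.pi * Complex.I * m * (x + y * Complex.I)) =
      -(4 * Real.pi * m * y) + -(2 * Real.pi * Complex.I * m * (x + y * Complex.I)) := by
    simp only [map_mul, map_add, Complex.conj_ofReal, Complex.conj_I, map_natCast, map_ofNat]
    linear_combination (4 * Real.pi * m * y : ℂ) * Complex.I_sq
  rw [h2, Complex.exp_add]
  ring

theorem integral_imMeasure (h : ℝ → ℂ) :
    ∫ y, h y ∂imMeasure = ∫ y in Ioi (0 : ℝ), ((y ^ 2)⁻¹ : ℝ) • h y := by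
  rw [imMeasure, integral_withDensity_eq_integral_toReal_smul (by fun_prop)
    (.of_forall fun _ => by simp)]
  refine integral_congr_ae (.of_forall fun y => ?_)
  simp only
  rw [ENNReal.toReal_ofReal (by positivity)]

/-- The factor `Γ(2k - 1) / (4πm)^{2k - 1}` in the Petersson formula. -/
noncomputable def peterssonFactor (m k : ℕ) : ℝ :=
  (1 / (4 * Real.pi * m)) ^ (2 * k - 1 : ℝ) * Real.Gamma (2 * k - 1)

theorem peterssonFactor_pos {m k : ℕ} (hm : 1 ≤ m) (hk : 2 ≤ k) : 0 < peterssonFactor m k := by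
  have h1 : (1 : ℝ) ≤ m := by exact_mod_cast hm
  have h2 : (2 : ℝ) ≤ k := by exact_mod_cast hk
  have := Real.pi_pos
  have h3 : 0 < Real.Gamma (2 * k - 1) := Real.Gamma_pos_of_pos (by linarith)
  unfold peterssonFactor
  positivity

theorem integral_pow_mul_exp {m k : ℕ} (hm : 1 ≤ m) (hk : 2 ≤ k) :
    ∫ y in Ioi (0 : ℝ), (y ^ 2)⁻¹ * (y ^ (2 * k) * Real.exp (-(4 * Real.pi * m * y))) =
      peterssonFactor m k := by
  have h1 : (1 : ℝ) ≤ m := by exact_mod_cast hm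
  have h2 : (2 : ℝ) ≤ k := by exact_mod_cast hk
  have := Real.pi_pos
  rw [peterssonFactor, ← Real.integral_rpow_mul_exp_neg_mul_Ioi (by linarith) (by positivity)]
  refine setIntegral_congr_fun measurableSet_Ioi fun y hy => ?_
  have hy : 0 < y := hy
  rw [← mul_assoc]
  congr 1
  rw [← Real.rpow_natCast y (2 * k), ← Real.rpow_natCast y 2, ← Real.rpow_neg hy.le,
    ← Real.rpow_add hy]
  congr 1
  push_cast
  ring

/-- By Fubini, the inner integral over x is a Fourier mean that does not depend on y, and what
remains is a Gamma integral. -/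
theorem integral_strip_unfolded {m k : ℕ} (hm : 1 ≤ m) (hk : 2 ≤ k) {f : ℍ → ℂ}
    (hd : MDifferentiable 𝓘(ℂ) 𝓘(ℂ) f) (hf : IsWeight k f)
    (hL2 : MemLp (fun z : ℍ => z.im ^ k * ‖f z‖) 2 (volume.restrict fd)) {y₀ : ℝ} (hy₀ : 0 < y₀) :
    ∫ z in strip, unfolded m k f z = peterssonFactor m k * fourierMean m f y₀ := by
  have hfm := measurable_of_mdifferentiable hd
  have hum := measurable_unfolded m k hfm
  have hint : IntegrableOn (unfolded m k f) strip := ⟨hum.aestronglyMeasurable,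
    lt_top_iff_ne_top.mpr (lintegral_unfolded_ne_top hm hk hfm hf hL2)⟩
  have hmap := map_ofCoords_restrict (S := Ico (0 : ℝ) 1) measurableSet_Ico
  change _ = volume.restrict strip at hmap
  rw [IntegrableOn, ← hmap] at hint
  have hint2 := (integrable_map_measure hum.aestronglyMeasurable
    measurable_ofCoords.aemeasurable).mp hint
  rw [← hmap, integral_map measurable_ofCoords.aemeasurable hum.aestronglyMeasurable]
  rw [integral_prod_symm (fun p => unfolded m k f (ofCoords p)) hint2, integral_imMeasure,
    ← integral_pow_mul_exp hm hk, ← integral_complex_ofReal, ← integral_mul_const]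
  refine setIntegral_congr_fun measurableSet_Ioi fun y hy => ?_
  have hy : 0 < y := hy
  simp only [unfolded_ofCoords m k f hy]
  rw [integral_const_mul, fourierMean_eq m hf hd hy₀ hy, fourierMean,
    intervalIntegral.integral_of_le zero_le_one, ← integral_Ico_eq_integral_Ioc,
    Complex.real_smul]
  push_cast
  ring

/-- The Petersson formula: the pairing with a Poincaré series is a Fourier coefficient. -/
theorem ip_poincareSeries {m k : ℕ} (hm : 1 ≤ m) (hk : 2 ≤ k) {f : ℍ → ℂ} {F : SH → ℂ}
    (hd : MDifferentiable 𝓘(ℂ) 𝓘(ℂ) f) (hF : ∀ p, F p = p.ζ ^ k * f p.z)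
    (hinv : ∀ g ∈ modularGroup, ∀ p, F (g • p) = F p)
    (hL2 : MemLp F 2 (dV.restrict {p | p.z ∈ fd})) {y₀ : ℝ} (hy₀ : 0 < y₀) :
    ip fd F (fun p => p.ζ ^ k * poincareSeries m k p.z) =
      peterssonFactor m k * fourierMean m f y₀ := by
  have hfm := measurable_of_mdifferentiable hd
  have hf : IsWeight k f := eq_smul_of_invariant hF hinv
  rw [memLp_iff_of_eq hfm hF] at hL2
  rw [← integral_strip_unfolded hm hk hd hf hL2 hy₀, ip_eq hfm
    (measurable_of_mdifferentiable (mdifferentiable_poincareSeries m hk)) hF fun p => rfl,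
    ← integral_unfold (measurable_unfolded m k hfm) (unfolded_T_zpow m hf)
      (lintegral_unfolded_ne_top hm hk hfm hf hL2)]
  simp_rw [tsum_unfolded hf]

end BohrSommerfeld

namespace BohrSommerfeld

open Set ModularGroup Filter Topology

/-! ### Definiteness of the inner product -/

theorem volume_pos_of_isOpen {U : Set ℍ} (hU : IsOpen U) (hne : U.Nonempty) : volume U ≠ 0 := by
  intro h0
  have hopen : IsOpen (UpperHalfPlane.coe '' U) := isOpenEmbedding_coe.isOpenMap U hU
  rw [volume_eq_lintegral, lintegral_eq_zero_iff (by fun_prop)] at h0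
  have h1 : ∀ᵐ w : ℂ, w ∉ UpperHalfPlane.coe '' U := by
    filter_upwards [(ae_restrict_iff' hopen.measurableSet).mp h0] with w hw hmem
    obtain ⟨z, hz, rfl⟩ := hmem
    simpa [z.im_ne_zero] using hw ⟨z, hz, rfl⟩
  have h2 : volume (UpperHalfPlane.coe '' U) = 0 := by
    rw [ae_iff] at h1
    simp only [not_not] at h1
    exact h1
  exact (hopen.measure_pos volume (hne.image _)).ne' h2

/-- By continuity f vanishes on the open set `fdo`, which contains 2i, and the identity theorem does
the rest. -/
theorem eq_zero_of_ae_eq_zero_fd {f : ℍ → ℂ} (hf : MDifferentiable 𝓘(ℂ) 𝓘(ℂ) f)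
    (h : ∀ᵐ z ∂(volume : Measure ℍ).restrict fd, f z = 0) : f = 0 := by
  have h0 : ∀ z ∈ fdo, f z = 0 := by
    intro z hz
    by_contra hne
    have hopen : IsOpen (fdo ∩ f ⁻¹' {0}ᶜ) :=
      isOpen_fdo.inter (isOpen_compl_singleton.preimage hf.continuous)
    refine volume_pos_of_isOpen hopen ⟨z, hz, hne⟩ ?_
    rw [ae_restrict_iff' measurableSet_fd, ae_iff] at h
    refine measure_mono_null ?_ h
    rintro w ⟨hw, hw'⟩ hcon
    exact hw' (hcon (fdo_subset_fd hw))
  obtain ⟨τ, hτ⟩ : fdo.Nonempty := by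
    refine ⟨⟨2 * Complex.I, by simp⟩, ?_, ?_⟩
    · simp
      norm_num
    · change |(2 * Complex.I).re| < 1 / 2
      norm_num
  refine eq_zero_of_frequently hf (τ := τ) (Eventually.frequently ?_)
  exact eventually_nhdsWithin_of_eventually_nhds
    (eventually_of_mem (isOpen_fdo.mem_nhds hτ) h0)

theorem eq_zero_of_ip_self {k : ℕ} {F : SH → ℂ} (hF : F ∈ hardy modularGroup fd k)
    (h0 : ip fd F F = 0) : F = 0 := by
  obtain ⟨⟨f, hd, hf⟩, -, hL2⟩ := hF
  have hfm := measurable_of_mdifferentiable hd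
  rw [memLp_iff_of_eq hfm hf] at hL2
  have hsq := hL2.integrable_sq
  rw [ip_eq hfm hfm hf hf] at h0
  have h1 : ∀ z : ℍ, (z.im : ℂ) ^ (2 * k) * (f z * conj (f z)) =
      (((z.im ^ k * ‖f z‖) ^ 2 : ℝ) : ℂ) := fun z => by
    rw [Complex.mul_conj, Complex.normSq_eq_norm_sq]
    push_cast
    ring
  simp_rw [h1] at h0
  rw [integral_complex_ofReal, Complex.ofReal_eq_zero,
    integral_eq_zero_iff_of_nonneg (fun z => sq_nonneg _) hsq] at h0
  have h2 : f = 0 := eq_zero_of_ae_eq_zero_fd hd <| by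
    filter_upwards [h0] with z hz
    simpa [z.im_ne_zero] using hz
  funext p
  rw [hf, h2]
  simp

theorem integrable_ip {k : ℕ} {F G : SH → ℂ} (hF : F ∈ hardy modularGroup fd k)
    (hG : G ∈ hardy modularGroup fd k) :
    Integrable (fun p => F p * conj (G p)) (dV.restrict {p | p.z ∈ fd}) :=
  hF.2.2.integrable_mul hG.2.2.star

/-- The difference of two states is in the Hardy space and pairs to zero with itself. -/
theorem IsState.unique {k : ℕ} {T : ℝ} {c : ℝ → SH} {u v : SH → ℂ}
    (hu : IsState modularGroup fd k T c u) (hv : IsState modularGroup fd k T c v) : u = v := by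
  have hmem := Submodule.sub_mem _ hu.1 hv.1
  refine sub_eq_zero.mp (eq_zero_of_ip_self hmem ?_)
  have h1 : ip fd (u - v) (u - v) = ip fd (u - v) u - ip fd (u - v) v := by
    rw [ip, ip, ip, ← integral_sub (integrable_ip hmem hu.1) (integrable_ip hmem hv.1)]
    refine integral_congr_ae (.of_forall fun p => ?_)
    simp only [Pi.sub_apply, map_sub]
    ring
  rw [h1, hu.2 _ hmem, hv.2 _ hmem, sub_self]

/-! ### Horizontal lines at height `k / 2πm` -/

theorem integral_lift {m k : ℕ} (hm : 1 ≤ m) (hk : 1 ≤ k) {γ : ℝ → ℍ} {y : ℝ}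
    (hy : y = k / (2 * Real.pi * m)) (hγ : ∀ t : ℝ, (γ t : ℂ) = y * Complex.I + t) {c : ℝ → SH}
    (hc : IsHorizontalLift c γ) {f : ℍ → ℂ} {F : SH → ℂ} (hF : ∀ p, F p = p.ζ ^ k * f p.z) :
    ∫ t in (0 : ℝ)..1, F (c t) = (c 0).ζ ^ k * (Real.exp (-k) : ℝ) * fourierMean m f y := by
  have hm0 : (m : ℂ) ≠ 0 := by exact_mod_cast (by omega : m ≠ 0)
  have hk0 : (k : ℂ) ≠ 0 := by exact_mod_cast (by omega : k ≠ 0)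
  have hpi : (Real.pi : ℂ) ≠ 0 := by exact_mod_cast Real.pi_ne_zero
  have hy0 : 0 < y := by rw [hy]; have := Real.pi_pos; positivity
  rw [fourierMean, ← intervalIntegral.integral_const_mul]
  refine intervalIntegral.integral_congr fun t _ => ?_
  have h1 : ofComplex (t + y * Complex.I) = γ t := by
    rw [← ofComplex_apply (γ t), hγ, add_comm]
  rw [hF, ζ_of_isHorizontalLift hc hy0 hγ t, hc.2, twisted, h1, mul_pow, ← Complex.exp_nat_mul]
  -- Here 2πmy = k is used: the rotation of ζᵏ becomes the Fourier kernel e^{-2πimz}, at the cost of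
  -- the constant e^{-k}.
  have h2 : (k : ℂ) * (-(t / y) * Complex.I) =
      ((-k : ℝ) : ℂ) + -(2 * Real.pi * Complex.I * m * (t + y * Complex.I)) := by
    rw [hy]
    push_cast
    field_simp
    linear_combination (k : ℂ) * Complex.I_sq
  rw [h2, Complex.exp_add, ← Complex.ofReal_exp]
  ring

theorem contDiff_line {γ : ℝ → ℍ} {y : ℝ} (hγ : ∀ t : ℝ, (γ t : ℂ) = y * Complex.I + t) :
    ContDiff ℝ ∞ (fun t => (γ t : ℂ)) := by
  simp_rw [hγ]
  exact contDiff_const.add Complex.ofRealCLM.contDiff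

theorem isBS_line {m k : ℕ} (hm : 1 ≤ m) (hk : 1 ≤ k) {γ : ℝ → ℍ} {y : ℝ}
    (hy : y = k / (2 * Real.pi * m)) (hγ : ∀ t : ℝ, (γ t : ℂ) = y * Complex.I + t) :
    IsBS modularGroup k 1 γ := by
  have hm0 : (m : ℂ) ≠ 0 := by exact_mod_cast (by omega : m ≠ 0)
  have hk0 : (k : ℂ) ≠ 0 := by exact_mod_cast (by omega : k ≠ 0)
  have hpi : (Real.pi : ℂ) ≠ 0 := by exact_mod_cast Real.pi_ne_zero
  have hy0 : 0 < y := by rw [hy]; have := Real.pi_pos; positivity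
  obtain ⟨c, hc⟩ := exists_isHorizontalLift hy0 hγ
  have hT : ∀ z : ℍ, j ((T : SL(2, ℤ)) : SL(2, ℝ)) z = 1 := fun z => by
    rw [j_int]; simp [T]
  refine ⟨hk, one_pos, contDiff_line hγ, ((T : SL(2, ℤ)) : SL(2, ℝ)), ⟨T, rfl⟩, fun t => ?_,
    c, hc, Complex.exp (-((1 : ℝ) / y) * Complex.I), ?_, ?_⟩
  · have h := coe_T_zpow_smul_eq (γ t) (n := 1)
    rw [zpow_one, hγ] at h
    refine UpperHalfPlane.ext ?_
    rw [hγ]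
    refine Eq.trans h ?_
    push_cast
    ring
  · rw [← Complex.exp_nat_mul, Complex.exp_eq_one_iff]
    refine ⟨-m, ?_⟩
    rw [hy]
    push_cast
    field_simp
  · rw [ζ_of_isHorizontalLift hc hy0 hγ 1, SH.ζ_smul, hT]
    simp [mul_comm]

/-- The hypothesis on a equates the coefficients of the Fourier mean in `ip_poincareSeries` and
`integral_lift`; a enters conjugated because the inner product is conjugate linear in its second
variable. -/
theorem isState_line {m k : ℕ} (hm : 1 ≤ m) (hk : 2 ≤ k) {γ : ℝ → ℍ} {y : ℝ}
    (hy : y = k / (2 * Real.pi * m)) (hγ : ∀ t : ℝ, (γ t : ℂ) = y * Complex.I + t) {c : ℝ → SH}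
    (hc : IsHorizontalLift c γ) {a : ℂ}
    (ha : conj a * peterssonFactor m k = (c 0).ζ ^ k * (Real.exp (-k) : ℝ)) :
    IsState modularGroup fd k 1 c fun p => a * (p.ζ ^ k * poincareSeries m k p.z) := by
  have hy0 : 0 < y := by
    have := Real.pi_pos
    rw [hy]; positivity
  refine ⟨Submodule.smul_mem _ a (poincareSeries_mem_hardy hm hk), ?_⟩
  rintro F ⟨⟨f, hd, hF⟩, hinv, hL2⟩
  have h1 : ip fd F (fun p => a * (p.ζ ^ k * poincareSeries m k p.z)) =
      conj a * ip fd F (fun p => p.ζ ^ k * poincareSeries m k p.z) := by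
    rw [ip, ip, ← integral_const_mul]
    refine integral_congr_ae (.of_forall fun p => ?_)
    simp only [map_mul]
    ring
  rw [h1, ip_poincareSeries hm hk hd hF hinv hL2 hy0, integral_lift hm (by omega) hy hγ hc hF,
    ← mul_assoc, ha]

end BohrSommerfeld

theorem mainTheorem12 (m k : ℕ) (hm : 1 ≤ m) (hk : 2 ≤ k) (γ : ℝ → UpperHalfPlane)
    (hγ : ∀ t : ℝ, (γ t : ℂ) = Complex.I * k / (2 * Real.pi * m) + t) :
    -- `γ` is a `BS_k` curve with domain `[0, 1]` in `X = SL(2, ℤ) \ ℍ`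
    BohrSommerfeld.IsBS BohrSommerfeld.modularGroup k 1 γ ∧
    -- the Poincaré series converges absolutely
    (∀ z : UpperHalfPlane, Summable fun q => ‖BohrSommerfeld.poincareCosetTerm m k z q‖) ∧
    -- up to a constant, the state is `ζᵏ P_{m,k}(z)`
    ∃ C : ℂ, C ≠ 0 ∧
      ∀ c : ℝ → BohrSommerfeld.SH, BohrSommerfeld.IsHorizontalLift c γ →
        ∃ w : ℂ, ‖w‖ = 1 ∧
          ∀ u : BohrSommerfeld.SH → ℂ,
            BohrSommerfeld.IsState BohrSommerfeld.modularGroup ModularGroup.fd k 1 c u ↔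
              u = fun p => w * C * (p.ζ ^ k * BohrSommerfeld.poincareSeries m k p.z) := by
  set y : ℝ := k / (2 * Real.pi * m) with hy
  have hγ' : ∀ t : ℝ, (γ t : ℂ) = y * Complex.I + t := fun t => by
    rw [hγ, hy]; push_cast; ring
  have hy0 : 0 < y := by
    have := Real.pi_pos
    rw [hy]; positivity
  have hyc : (y : ℂ) ≠ 0 := by exact_mod_cast hy0.ne'
  have hD : (BohrSommerfeld.peterssonFactor m k : ℂ) ≠ 0 := by
    exact_mod_cast (BohrSommerfeld.peterssonFactor_pos hm hk).ne'
  have he : ((Real.exp (-k) : ℝ) : ℂ) ≠ 0 := by exact_mod_cast (Real.exp_pos _).ne'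
  refine ⟨BohrSommerfeld.isBS_line hm (by omega) hy hγ',
    BohrSommerfeld.summable_norm_poincareCosetTerm m hk,
    -- The modulus of the coefficient solving the equation in `isState_line`: |ζ(0)| = y for every
    -- lift, so only the phase of ζ(0) depends on the lift.
    (y : ℂ) ^ k * (Real.exp (-k) : ℝ) / BohrSommerfeld.peterssonFactor m k,
    div_ne_zero (mul_ne_zero (pow_ne_zero _ hyc) he) hD, fun c hc => ?_⟩
  have hζ : ‖(c 0).ζ‖ = y := by
    rw [BohrSommerfeld.SH.norm_ζ, hc.2, ← UpperHalfPlane.coe_im, hγ']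
    simp
  -- The conjugate phase of ζ(0)ᵏ.
  refine ⟨conj ((c 0).ζ / y) ^ k, ?_, fun u => ?_⟩
  · rw [norm_pow, RCLike.norm_conj, norm_div, hζ, Complex.norm_of_nonneg hy0.le,
      div_self hy0.ne', one_pow]
  · have hstate := BohrSommerfeld.isState_line hm hk hy hγ' hc
      (a := conj ((c 0).ζ / y) ^ k *
        ((y : ℂ) ^ k * (Real.exp (-k) : ℝ) / BohrSommerfeld.peterssonFactor m k)) (by
        simp only [map_mul, map_div₀, map_pow, Complex.conj_conj, Complex.conj_ofReal]
        field_simp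
        rw [← mul_pow, div_mul_cancel₀ _ hyc])
    exact ⟨fun hu => hu.unique hstate, fun hu => hu ▸ hstate⟩
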